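/- Let $\Omega\subset\mathbb R^2$ be a bounded open set and let $\omega$ be Lipschitz continuous on $\overline\Omega$. Write $\{a,b\}=\partial_y a\,\partial_x b-\partial_x a\,\partial_y b$ and let $\mathcal J(\omega):H^1_0(\Omega)\to H^{-1}(\Omega)$ be the weak Poisson operator, i.e. the bounded linear map defined by $$(\mathcal J(\omega)\psi,\phi)=\int_\Omega \omega\,\{\psi,\phi\}\,dx\qquad(\psi,\phi\in H^1_0(\Omega)),$$ so that formally $\mathcal J(\omega)\psi=\{\omega,\psi\}$. Say that an open set $U\subseteq\Omega$ (not necessarily connected) is bounded by a level set of $\omega$ if $\omega$ is constant on $\partial U$, and let $\Omega_\circ(\omega)$ be the union of all such $U$. A real number $h$ is the height of a plateau of $\omega$ in an open set $U$ if $\omega=h$ on some nonempty open subset of $U$. Let $Y$ be the filled step function: $Y(\xi)=\{0\}$ for $\xi<0$, $Y(0)=[0,1]$, $Y(\xi)=\{1\}$ for $\xi>0$. For a Lipschitz function $g_L:\mathbb R\to\mathbb R$, an integer $\nu\ge 0$, reals $\alpha_1,\dots,\alpha_\nu$ and $\omega_1,\dots,\omega_\nu$, consider the set-valued function $$g(\xi)=g_L(\xi)+\sum_{\ell=1}^{\nu}\alpha_\ell\,Y(\xi-\omega_\ell).\tag{1}$$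 For $\psi\in H^1_0(\Omega)$, "$\psi=g(\omega)$ on $U$" means $\psi(x)\in g(\omega(x))$ for almost every $x\in U$. **Theorem.** Suppose that $\Omega_\circ(\omega)\neq\emptyset$. Then: (a) $\mathrm{Ker}(\mathcal J(\omega))$ contains nontrivial elements. More precisely, for every nonempty open $U\subseteq\Omega$ bounded by a level set of $\omega$ there are a function $g$ of the form (1), whose $\omega_\ell$ are heights of plateaus of $\omega$ in $U$, with $0\in g(\omega(x))$ for all $x\in\partial U$, and a nonzero $\psi\in \mathrm{Ker}(\mathcal J(\omega))$ such that $\psi=g(\omega)$ on $U$ and $\psi=0$ almost everywhere on $\Omega\setminus U$. (b) Let $g$ be any function of the form (1) such that every $\omega_\ell$ is the height of a plateau of $\omega$ in $\Omega$ and $0\in g(\omega(x))$ for all $x\in\partial\Omega$. Then every $\psi\in H^1_0(\Omega)$ with $\psi=g(\omega)$ on $\Omega$ belongs to $\mathrm{Ker}(\mathcal J(\omega))$. (c) Let $g$ be as in (b), and suppose moreover that the plateaus fill the gaps at the jumps, i.e. for every $\ell$ the sets $\{x\in\Omega:\omega(x)<\omega_\ell\}$ and $\{x\in\Omega:\omega(x)>\omega_\ell\}$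 have disjoint closures, and that at every $x\in\partial\Omega$ either $g(\omega(x))=\{0\}$ or $\omega$ takes only the value $\omega(x)$ in $\Omega$ near $x$. Then there is $\psi\in\mathrm{Ker}(\mathcal J(\omega))$ with $\psi=g(\omega)$ on $\Omega$. In particular (case $\nu=0$), if $g_L=0$ on $\omega(\partial\Omega)$, then $g_L(\omega)\in\mathrm{Ker}(\mathcal J(\omega))$. -/

import Mathlib

open MeasureTheory Set Filter Topology
open scoped NNReal Gradient

/-- The Euclidean plane. -/
abbrev Plane : Type := EuclideanSpace ℝ (Fin 2)

/-- `φ` is a test function on `Ω`: smooth, with compact support contained in `Ω`. -/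
structure IsTestFunction (Ω : Set Plane) (φ : Plane → ℝ) : Prop where
  smooth : ContDiff ℝ (⊤ : ℕ∞) φ
  hasCompactSupport : HasCompactSupport φ
  tsupport_subset : tsupport φ ⊆ Ω

/-- The ambient Hilbert space `L²(Ω) × L²(Ω; ℝ²)` of pairs (function, gradient), with the
Hilbert norm `(‖u‖² + ‖G‖²)^(1/2)`. -/
abbrev FunGrad (Ω : Set Plane) : Type :=
  WithLp 2 (Lp ℝ 2 (volume.restrict Ω) × Lp Plane 2 (volume.restrict Ω))

/-- The space of pairs `(φ, ∇φ)` with `φ` a test function on `Ω`. -/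
noncomputable def testPairs (Ω : Set Plane) : Submodule ℝ (FunGrad Ω) where
  carrier := {p | ∃ φ : Plane → ℝ, IsTestFunction Ω φ ∧
    (p.fst : Plane → ℝ) =ᵐ[volume.restrict Ω] φ ∧
    (p.snd : Plane → Plane) =ᵐ[volume.restrict Ω] ∇ φ}
  zero_mem' := by
    refine ⟨0, ⟨contDiff_const, HasCompactSupport.zero, by simp [tsupport]⟩, ?_, ?_⟩
    · exact Lp.coeFn_zero _ _ _
    · refine (Lp.coeFn_zero _ _ _).trans (Eventually.of_forall fun x => ?_)
      have : gradient (0 : Plane → ℝ) x = 0 := gradient_const x (0 : ℝ)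
      exact this.symm
  add_mem' := by
    rintro p q ⟨φ, hφ, h1, h2⟩ ⟨χ, hχ, h3, h4⟩
    refine ⟨φ + χ, ⟨hφ.smooth.add hχ.smooth, hφ.hasCompactSupport.add hχ.hasCompactSupport,
      (tsupport_add φ χ).trans (union_subset hφ.tsupport_subset hχ.tsupport_subset)⟩, ?_, ?_⟩
    · exact (Lp.coeFn_add p.fst q.fst).trans (h1.add h3)
    · refine (Lp.coeFn_add p.snd q.snd).trans ((h2.add h4).trans
        (Eventually.of_forall fun x => ?_))
      have d1 : DifferentiableAt ℝ φ x := hφ.smooth.differentiable (by simp) x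
      have d2 : DifferentiableAt ℝ χ x := hχ.smooth.differentiable (by simp) x
      simp only [gradient, Pi.add_apply, fderiv_add d1 d2, map_add]
  smul_mem' := by
    rintro c p ⟨φ, hφ, h1, h2⟩
    refine ⟨c • φ, ⟨hφ.smooth.const_smul c, hφ.hasCompactSupport.smul_left (f := fun _ => c),
      (tsupport_smul_subset_right (fun _ => c) φ).trans hφ.tsupport_subset⟩, ?_, ?_⟩
    · exact (Lp.coeFn_smul c p.fst).trans (h1.const_smul c)
    · refine (Lp.coeFn_smul c p.snd).trans ((h2.const_smul c).trans
        (Eventually.of_forall fun x => ?_))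
      have d1 : DifferentiableAt ℝ φ x := hφ.smooth.differentiable (by simp) x
      simp only [gradient, Pi.smul_apply, fderiv_const_smul d1 c, map_smul]

/-- The Sobolev space `H¹₀(Ω)`: the closure of the test functions in the `H¹` norm. An element is
recorded as the pair of the function and its weak gradient. -/
abbrev H10 (Ω : Set Plane) : Type := ↥(testPairs Ω).topologicalClosure

/-- The function underlying an element of `H¹₀(Ω)` (defined almost everywhere on `Ω`). -/
noncomputable def H10.fn {Ω : Set Plane} (u : H10 Ω) : Plane → ℝ := (u : FunGrad Ω).fst

/-- The weak gradient of an element of `H¹₀(Ω)`. -/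
noncomputable def H10.grad {Ω : Set Plane} (u : H10 Ω) : Plane → Plane := (u : FunGrad Ω).snd

/-- `H⁻¹(Ω)`, the dual of `H¹₀(Ω)`. -/
abbrev Hminus1 (Ω : Set Plane) : Type := StrongDual ℝ (H10 Ω)

/-- The Poisson bracket `{a, b} = ∂_y a ∂_x b - ∂_x a ∂_y b` in terms of the gradients of
`a` and `b`; coordinate `0` is `x` and coordinate `1` is `y`. -/
def bracket (p q : Plane) : ℝ := p 1 * q 0 - p 0 * q 1

lemma abs_bracket_le (p q : Plane) : |bracket p q| ≤ ‖p‖ * ‖q‖ := by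
  rw [EuclideanSpace.norm_eq, EuclideanSpace.norm_eq, ← Real.sqrt_mul (by positivity)]
  apply Real.abs_le_sqrt
  simp only [bracket, Fin.sum_univ_two, Real.norm_eq_abs, sq_abs]
  nlinarith [sq_nonneg (p 0 * q 0 + p 1 * q 1)]

lemma exists_ae_bound {Ω : Set Plane} (hb : Bornology.IsBounded Ω) {ω : Plane → ℝ}
    (hω : ContinuousOn ω (closure Ω)) :
    ∃ C : ℝ, 0 ≤ C ∧ ∀ᵐ x ∂(volume.restrict Ω), |ω x| ≤ C := by
  obtain ⟨C, hC⟩ := hb.isCompact_closure.exists_bound_of_continuousOn hω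
  refine ⟨max C 0, le_max_right _ _, ?_⟩
  have h : ∀ᵐ x ∂(volume.restrict (closure Ω)), |ω x| ≤ max C 0 :=
    ae_restrict_of_forall_mem isClosed_closure.measurableSet
      fun x hx => (hC x hx).trans (le_max_left _ _)
  exact ae_mono (Measure.restrict_mono subset_closure le_rfl) h

lemma integrable_norm_mul_norm {Ω : Set Plane} (u v : H10 Ω) :
    Integrable (fun x => ‖u.grad x‖ * ‖v.grad x‖) (volume.restrict Ω) :=
  (Lp.memLp (u : FunGrad Ω).snd).norm.integrable_mul (Lp.memLp (v : FunGrad Ω).snd).norm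

lemma aesm_bracket {Ω : Set Plane} (u v : H10 Ω) :
    AEStronglyMeasurable (fun x => bracket (u.grad x) (v.grad x)) (volume.restrict Ω) := by
  have hc : Continuous fun z : Plane × Plane => bracket z.1 z.2 := by
    unfold bracket; fun_prop
  exact hc.comp_aestronglyMeasurable
    ((Lp.aestronglyMeasurable (u : FunGrad Ω).snd).prodMk
      (Lp.aestronglyMeasurable (v : FunGrad Ω).snd))

lemma ae_poisson_bound {Ω : Set Plane} {ω : Plane → ℝ} {C : ℝ}
    (h : ∀ᵐ x ∂(volume.restrict Ω), |ω x| ≤ C) (u v : H10 Ω) :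
    ∀ᵐ x ∂(volume.restrict Ω),
      ‖ω x * bracket (u.grad x) (v.grad x)‖ ≤ C * (‖u.grad x‖ * ‖v.grad x‖) := by
  filter_upwards [h] with x hx
  rw [norm_mul, Real.norm_eq_abs, Real.norm_eq_abs]
  exact mul_le_mul hx (abs_bracket_le _ _) (abs_nonneg _) ((abs_nonneg _).trans hx)

lemma integrable_poisson {Ω : Set Plane} (hb : Bornology.IsBounded Ω) {ω : Plane → ℝ}
    (hω : ContinuousOn ω (closure Ω)) (u v : H10 Ω) :
    Integrable (fun x => ω x * bracket (u.grad x) (v.grad x)) (volume.restrict Ω) := by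
  obtain ⟨C, -, hC⟩ := exists_ae_bound hb hω
  have hm : AEStronglyMeasurable ω (volume.restrict Ω) :=
    (hω.aestronglyMeasurable isClosed_closure.measurableSet).mono_measure
      (Measure.restrict_mono subset_closure le_rfl)
  exact ((integrable_norm_mul_norm u v).const_mul C).mono' (hm.mul (aesm_bracket u v))
    (ae_poisson_bound hC u v)

lemma integral_norm_mul_norm_le {Ω : Set Plane} (u v : H10 Ω) :
    ∫ x in Ω, ‖u.grad x‖ * ‖v.grad x‖ ≤ ‖u‖ * ‖v‖ := by
  have key : ∀ w : H10 Ω, ‖(Lp.memLp (w : FunGrad Ω).snd).norm.toLp‖ ≤ ‖w‖ := by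
    intro w
    have h1 : ‖(Lp.memLp (w : FunGrad Ω).snd).norm.toLp‖ = ‖(w : FunGrad Ω).snd‖ := by
      rw [Lp.norm_toLp, eLpNorm_norm, Lp.norm_def]
    rw [h1]
    exact WithLp.norm_snd_le _ (w : FunGrad Ω)
  have h2 : ∫ x in Ω, ‖u.grad x‖ * ‖v.grad x‖ =
      inner ℝ (Lp.memLp (v : FunGrad Ω).snd).norm.toLp
        (Lp.memLp (u : FunGrad Ω).snd).norm.toLp := by
    rw [L2.inner_def]
    refine integral_congr_ae ?_
    filter_upwards [(Lp.memLp (u : FunGrad Ω).snd).norm.coeFn_toLp,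
      (Lp.memLp (v : FunGrad Ω).snd).norm.coeFn_toLp] with x hx hy
    simp only [hx, hy]
    simp [H10.grad]
  rw [h2]
  refine (real_inner_le_norm _ _).trans ?_
  rw [mul_comm]
  exact mul_le_mul (key u) (key v) (norm_nonneg _) (norm_nonneg _)

/-- The bilinear form `(ψ, φ) ↦ (ω, {ψ, φ}) = ∫_Ω ω {ψ, φ}` on `H¹₀(Ω)`. -/
noncomputable def poissonForm (Ω : Set Plane) (hb : Bornology.IsBounded Ω) (ω : Plane → ℝ)
    (hω : ContinuousOn ω (closure Ω)) : H10 Ω →ₗ[ℝ] H10 Ω →ₗ[ℝ] ℝ :=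
  LinearMap.mk₂ ℝ (fun ψ φ => ∫ x in Ω, ω x * bracket (ψ.grad x) (φ.grad x))
    (by
      intro u v w
      rw [← integral_add (integrable_poisson hb hω u w) (integrable_poisson hb hω v w)]
      refine integral_congr_ae ?_
      filter_upwards [Lp.coeFn_add (u : FunGrad Ω).snd (v : FunGrad Ω).snd] with x hx
      have : (u + v).grad x = u.grad x + v.grad x := hx
      rw [this]; simp only [bracket, PiLp.add_apply]; ring)
    (by
      intro c u w
      rw [smul_eq_mul, ← integral_const_mul]
      refine integral_congr_ae ?_
      filter_upwards [Lp.coeFn_smul c (u : FunGrad Ω).snd] with x hx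
      have : (c • u).grad x = c • u.grad x := hx
      rw [this]; simp only [bracket, PiLp.smul_apply, smul_eq_mul]; ring)
    (by
      intro w u v
      rw [← integral_add (integrable_poisson hb hω w u) (integrable_poisson hb hω w v)]
      refine integral_congr_ae ?_
      filter_upwards [Lp.coeFn_add (u : FunGrad Ω).snd (v : FunGrad Ω).snd] with x hx
      have : (u + v).grad x = u.grad x + v.grad x := hx
      rw [this]; simp only [bracket, PiLp.add_apply]; ring)
    (by
      intro c w u
      rw [smul_eq_mul, ← integral_const_mul]
      refine integral_congr_ae ?_
      filter_upwards [Lp.coeFn_smul c (u : FunGrad Ω).snd] with x hx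
      have : (c • u).grad x = c • u.grad x := hx
      rw [this]; simp only [bracket, PiLp.smul_apply, smul_eq_mul]; ring)

lemma exists_poissonForm_bound (Ω : Set Plane) (hb : Bornology.IsBounded Ω) (ω : Plane → ℝ)
    (hω : ContinuousOn ω (closure Ω)) :
    ∃ C : ℝ, ∀ ψ φ : H10 Ω, ‖poissonForm Ω hb ω hω ψ φ‖ ≤ C * ‖ψ‖ * ‖φ‖ := by
  obtain ⟨C, hC0, hC⟩ := exists_ae_bound hb hω
  refine ⟨C, fun ψ φ => ?_⟩
  calc ‖∫ x in Ω, ω x * bracket (ψ.grad x) (φ.grad x)‖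
      ≤ ∫ x in Ω, C * (‖ψ.grad x‖ * ‖φ.grad x‖) :=
        norm_integral_le_of_norm_le ((integrable_norm_mul_norm ψ φ).const_mul C)
          (ae_poisson_bound hC ψ φ)
    _ = C * ∫ x in Ω, ‖ψ.grad x‖ * ‖φ.grad x‖ := integral_const_mul _ _
    _ ≤ C * (‖ψ‖ * ‖φ‖) := mul_le_mul_of_nonneg_left (integral_norm_mul_norm_le ψ φ) hC0
    _ = C * ‖ψ‖ * ‖φ‖ := by ring

/-- The weak Poisson operator `J(ω) : H¹₀(Ω) → H⁻¹(Ω)`, a bounded linear map, defined by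
`(J(ω) ψ, φ) = (ω, {ψ, φ})`; formally `J(ω) ψ = {ω, ψ}`. -/
noncomputable def poissonOp (Ω : Set Plane) (hb : Bornology.IsBounded Ω) (ω : Plane → ℝ)
    (hω : ContinuousOn ω (closure Ω)) : H10 Ω →L[ℝ] Hminus1 Ω :=
  (poissonForm Ω hb ω hω).mkContinuousOfExistsBound₂ (exists_poissonForm_bound Ω hb ω hω)

/-- `poissonOp` evaluates to the integral `(ω, {ψ, φ})`. -/
lemma poissonOp_apply (Ω : Set Plane) (hb : Bornology.IsBounded Ω) (ω : Plane → ℝ)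
    (hω : ContinuousOn ω (closure Ω)) (ψ φ : H10 Ω) :
    poissonOp Ω hb ω hω ψ φ = ∫ x in Ω, ω x * bracket (ψ.grad x) (φ.grad x) := rfl

/-- `U` is a region (an open set, not necessarily connected) in `Ω` that is bounded by a level
set of `ω`: the function `ω` is constant on the boundary of `U`. -/
def BoundedByLevelSet (Ω : Set Plane) (ω : Plane → ℝ) (U : Set Plane) : Prop :=
  IsOpen U ∧ U ⊆ Ω ∧ ∃ c : ℝ, ∀ x ∈ frontier U, ω x = c

/-- `Ω∘(ω)`: the largest region in `Ω` bounded by level sets of `ω`, that is, the union of all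
the regions in `Ω` that are bounded by a level set of `ω`. -/
def innerRegion (Ω : Set Plane) (ω : Plane → ℝ) : Set Plane :=
  ⋃₀ {U | BoundedByLevelSet Ω ω U}

/-- `h` is the height of a plateau of `ω` in `U`: `ω = h` on some nonempty open subset of `U`. -/
def IsPlateauHeight (U : Set Plane) (ω : Plane → ℝ) (h : ℝ) : Prop :=
  (interior {x | x ∈ U ∧ ω x = h}).Nonempty

/-- The filled step function `Y`, whose graph is connected by the full interval `[0, 1]`
at the jump. -/
def filledStep (ξ : ℝ) : Set ℝ :=
  {y | (ξ < 0 → y = 0) ∧ (ξ = 0 → y ∈ Icc (0 : ℝ) 1) ∧ (0 < ξ → y = 1)}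

/-- The set-valued function `g(ξ) = g_L(ξ) + ∑ α_ℓ Y(ξ - h_ℓ)`. -/
def filledFun (gL : ℝ → ℝ) {ν : ℕ} (α h : Fin ν → ℝ) (ξ : ℝ) : Set ℝ :=
  {t | ∃ y : Fin ν → ℝ, (∀ l, y l ∈ filledStep (ξ - h l)) ∧ t = gL ξ + ∑ l, α l * y l}

/-!
For smooth functions the assertion is that `{ω, g(ω)} = g'(ω) {ω, ω} = 0`. In the weak setting
one derivative is available for `ω` and one for `ψ`, but none for `g`, and `g` may jump.

Moving the derivative from `ψ` to `ω` gives `(ω, {ψ, φ}) = ∫_Ω ψ {φ, ω}` for test functions `φ`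
(`poissonOp_apply_test`). Hence if `ψ ∇ω` is almost everywhere the gradient of a Lipschitz function
`H`, then `(ω, {ψ, φ}) = ∫ {φ, H}`, which is zero because second derivatives of `φ` commute; so `ψ`
lies in the kernel (`mem_ker_poissonOp`). For `ψ = g(ω)` one takes `H = G(ω)` with `G` a primitive
of `g`: the filled jump at height `h` contributes `α (ω - h)₊` to `H`, and whichever value `ψ` takes
at that height is harmless, since `∇ω = 0` almost everywhere on `{ω = h}`
(`mem_ker_of_ae_mem_filledFun`).

It remains to find elements of `H¹₀(Ω)` of the required form. The source is that a Lipschitz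
function vanishing off the bounded open set `Ω` belongs to `H¹₀(Ω)`
(`LipschitzWith.representsH10`), and that a Lipschitz function vanishing on `∂U` remains Lipschitz
when it is cut off outside `U` (`lipschitzWith_indicator_of_frontier`).

* If `ω = c` on `∂U` but not on all of `U`, then `ψ = (ω - c) 1_U` is a kernel element, with
  `H = ψ² / 2`. If `ω = c` on `U`, every element of `H¹₀(U)` is one, with `H = 0`
  (`exists_ker_of_boundedByLevelSet`).
* If the plateaus fill the gaps, the jump `Y(ω - h)` has a Lipschitz selection: `{ω < h}` and
  `{ω > h}` have disjoint compact closures, hence positive distance. The part of `∂Ω` at height `h`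
  where `g(h) ≠ {0}` is a third compact set, disjoint from these two because `ω` is constant nearby,
  and on it the selection is given the value that makes `g(ω)` vanish
  (`exists_H10_mem_filledFun`).
-/

/-! ### Differentiation of Lipschitz functions on level sets -/

/-- The derivative of a Lipschitz function vanishes almost everywhere on a level set: there the
function is approximated to order zero by the linear map `0`. -/
lemma LipschitzWith.ae_fderiv_eq_zero_of_eq {f : Plane → ℝ} {K : ℝ≥0} (hf : LipschitzWith K f)
    (h : ℝ) : ∀ᵐ x : Plane, f x = h → fderiv ℝ f x = 0 := by
  obtain ⟨e, he⟩ := exists_ne (0 : Plane)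
  set s : Set Plane := {x | DifferentiableAt ℝ f x} ∩ f ⁻¹' {h} with hs
  have hsm : MeasurableSet s :=
    (measurableSet_of_differentiableAt ℝ f).inter
      (hf.continuous.measurable (measurableSet_singleton h))
  -- `norm_fderiv_sub_le` is stated for endomorphisms, so `f` is multiplied by a vector `e ≠ 0`
  have happ : ApproximatesLinearOn (fun x => f x • e) (0 : Plane →L[ℝ] Plane) s 0 := by
    intro x hx y hy
    have hx' : f x = h := hx.2
    have hy' : f y = h := hy.2
    simp [hx', hy']
  have key := happ.norm_fderiv_sub_le volume hsm (fun x => (fderiv ℝ f x).smulRight e)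
    (fun x hx => (hx.1.hasFDerivAt.smul_const e).hasFDerivWithinAt)
  rw [ae_restrict_iff' hsm] at key
  filter_upwards [key, hf.ae_differentiableAt] with x hx hd hxh
  have h0 := hx ⟨hd, hxh⟩
  simp only [sub_zero, nonpos_iff_eq_zero, nnnorm_eq_zero] at h0
  ext v
  have := congrArg (fun A : Plane →L[ℝ] Plane => A v) h0
  simpa [he] using this

/-- The chain rule for `(w - h)₊`: at height `h` every value in `[0, 1]` serves as the derivative
of `(·)₊`, because `∇w = 0` almost everywhere there. -/
lemma ae_hasFDerivAt_max_sub {w : Plane → ℝ} {K : ℝ≥0} (hw : LipschitzWith K w) (h : ℝ) :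
    ∀ᵐ x : Plane, ∀ y ∈ filledStep (w x - h),
      HasFDerivAt (fun z => max (w z - h) 0) (y • fderiv ℝ w x) x := by
  filter_upwards [hw.ae_differentiableAt, hw.ae_fderiv_eq_zero_of_eq h] with x hd h0 y hy
  have hc : ContinuousAt w x := hw.continuous.continuousAt
  rcases lt_trichotomy (w x) h with hlt | heq | hgt
  · rw [hy.1 (by linarith), zero_smul]
    refine (hasFDerivAt_const (0 : ℝ) x).congr_of_eventuallyEq ?_
    filter_upwards [hc.eventually_lt_const hlt] with z hz
    exact max_eq_right (by linarith)
  · have hd0 := hd.hasFDerivAt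
    rw [h0 heq] at hd0 ⊢
    rw [smul_zero]
    rw [hasFDerivAt_iff_isLittleO] at hd0 ⊢
    refine Asymptotics.IsBigO.trans_isLittleO (Asymptotics.IsBigO.of_bound 1 ?_) hd0
    refine Eventually.of_forall fun z => ?_
    simp only [heq, _root_.zero_apply, sub_self, max_self, sub_zero, one_mul,
      Real.norm_eq_abs]
    simpa using abs_max_sub_max_le_abs (w z - h) 0 0
  · rw [hy.2.2 (by linarith), one_smul]
    refine (hd.hasFDerivAt.sub_const h).congr_of_eventuallyEq ?_
    filter_upwards [hc.eventually_const_lt hgt] with z hz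
    exact max_eq_left (by linarith)

/-! ### The bracket of two gradients has zero integral -/

lemma gradient_apply_eq_fderiv {f : Plane → ℝ} (x : Plane) (i : Fin 2) :
    (∇ f x) i = fderiv ℝ f x (EuclideanSpace.single i 1) := by
  rw [← inner_gradient_left, real_inner_comm, EuclideanSpace.inner_single_left]
  simp

lemma norm_gradient_le {f : Plane → ℝ} {K : ℝ≥0} (hf : LipschitzWith K f) (x : Plane) :
    ‖∇ f x‖ ≤ K := by
  rw [gradient, LinearIsometryEquiv.norm_map]
  exact norm_fderiv_le_of_lipschitz ℝ hf

lemma aestronglyMeasurable_gradient {f : Plane → ℝ} {μ : Measure Plane} :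
    AEStronglyMeasurable (∇ f) μ :=
  ((InnerProductSpace.toDual ℝ Plane).symm.continuous.measurable.comp
    (measurable_fderiv ℝ f)).aestronglyMeasurable

lemma integrable_bracket_gradient {φ a : Plane → ℝ} (hφ : ContDiff ℝ (⊤ : ℕ∞) φ)
    (hc : HasCompactSupport φ) {K : ℝ≥0} (ha : LipschitzWith K a) :
    Integrable (fun x => bracket (∇ φ x) (∇ a x)) := by
  have h1 : Integrable (fun x => ‖fderiv ℝ φ x‖) :=
    ((hφ.continuous_fderiv (by simp)).integrable_of_hasCompactSupport (hc.fderiv ℝ)).norm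
  have hb : Continuous fun z : Plane × Plane => bracket z.1 z.2 := by
    unfold bracket; fun_prop
  refine (h1.mul_const K).mono' (hb.comp_aestronglyMeasurable
    (aestronglyMeasurable_gradient.prodMk aestronglyMeasurable_gradient))
    (Eventually.of_forall fun x => (abs_bracket_le _ _).trans ?_)
  have : ‖∇ φ x‖ = ‖fderiv ℝ φ x‖ := by rw [gradient, LinearIsometryEquiv.norm_map]
  rw [this]
  exact mul_le_mul_of_nonneg_left (norm_gradient_le ha x) (norm_nonneg _)

/-- Both sides become integrals of `a` against a second derivative of `φ`, which is symmetric. -/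
lemma integral_fderiv_apply_mul_fderiv_apply_comm {φ a : Plane → ℝ} (hφ : ContDiff ℝ (⊤ : ℕ∞) φ)
    (hc : HasCompactSupport φ) {K : ℝ≥0} (ha : LipschitzWith K a) (u v : Plane) :
    ∫ x, fderiv ℝ a x u * fderiv ℝ φ x v = ∫ x, fderiv ℝ a x v * fderiv ℝ φ x u := by
  have smooth : ∀ v, ContDiff ℝ (⊤ : ℕ∞) (fun x => fderiv ℝ φ x v) := fun v =>
    (hφ.fderiv_right (m := (⊤ : ℕ∞)) (by simp)).clm_apply contDiff_const
  have supp : ∀ v, HasCompactSupport (fun x => fderiv ℝ φ x v) := fun v => hc.fderiv_apply ℝ v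
  have key : ∀ u v, ∫ x, fderiv ℝ a x u * fderiv ℝ φ x v =
      ∫ x, fderiv ℝ (fderiv ℝ φ) x (-u) v * a x := by
    intro u v
    obtain ⟨D, hD⟩ := ContDiff.lipschitzWith_of_hasCompactSupport (supp v) (smooth v) (by simp)
    have h1 := ha.integral_lineDeriv_mul_eq (μ := volume) hD (supp v) u
    have e1 : ∫ x, fderiv ℝ a x u * fderiv ℝ φ x v = ∫ x, lineDeriv ℝ a x u * fderiv ℝ φ x v := by
      refine integral_congr_ae ?_
      filter_upwards [ha.ae_differentiableAt] with x hx
      simp only [hx.lineDeriv_eq_fderiv]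
    rw [e1, h1]
    refine integral_congr_ae (Eventually.of_forall fun x => ?_)
    have hd : DifferentiableAt ℝ (fderiv ℝ φ) x :=
      (hφ.fderiv_right (m := (⊤ : ℕ∞)) (by simp)).differentiable (by simp) x
    simp only [((smooth v).differentiable (by simp) x).lineDeriv_eq_fderiv]
    rw [fderiv_clm_apply hd (differentiableAt_const v)]
    simp
  rw [key u v, key v u]
  refine integral_congr_ae (Eventually.of_forall fun x => ?_)
  have hsymm : IsSymmSndFDerivAt ℝ φ x :=
    (hφ.contDiffAt (x := x)).isSymmSndFDerivAt
      (by simpa using ENat.LEInfty.out)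
  simp only [map_neg, _root_.neg_apply]
  rw [hsymm.eq u v]

lemma integral_bracket_gradient_eq_zero {φ a : Plane → ℝ} (hφ : ContDiff ℝ (⊤ : ℕ∞) φ)
    (hc : HasCompactSupport φ) {K : ℝ≥0} (ha : LipschitzWith K a) :
    ∫ x, bracket (∇ φ x) (∇ a x) = 0 := by
  have hint : ∀ u v, Integrable (fun x => fderiv ℝ a x u * fderiv ℝ φ x v) := by
    intro u v
    have h1 : Integrable (fun x => fderiv ℝ φ x v) :=
      ((hφ.continuous_fderiv (by simp)).clm_apply
        continuous_const).integrable_of_hasCompactSupport (hc.fderiv_apply ℝ v)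
    refine h1.bdd_mul (c := K * ‖u‖) (measurable_fderiv_apply_const ℝ a u).aestronglyMeasurable
      (Eventually.of_forall fun x => ?_)
    exact (ContinuousLinearMap.le_opNorm _ _).trans
      (mul_le_mul_of_nonneg_right (norm_fderiv_le_of_lipschitz ℝ ha) (norm_nonneg _))
  have h := integral_fderiv_apply_mul_fderiv_apply_comm hφ hc ha
    (EuclideanSpace.single 0 1) (EuclideanSpace.single 1 1)
  rw [← sub_eq_zero, ← integral_sub (hint _ _) (hint _ _)] at h
  rw [← h]
  refine integral_congr_ae (Eventually.of_forall fun x => ?_)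
  simp only [bracket, gradient_apply_eq_fderiv]
  ring

/-! ### Lipschitz functions with prescribed values -/

lemma lipschitzWith_indicator_of_frontier {U : Set Plane} {f : Plane → ℝ} {K : ℝ≥0}
    (hf : LipschitzWith K f) (h0 : ∀ x ∈ frontier U, f x = 0) :
    LipschitzWith K (U.indicator f) := by
  have key : ∀ x ∈ U, ∀ y ∉ U, |f x| ≤ K * dist x y := by
    intro x hx y hy
    -- a point of `frontier U` nearest to `x` is at least as close as `y`
    obtain ⟨z, hz, hxz⟩ := exists_mem_frontier_infDist_compl_eq_dist hx
      (fun h => hy (h ▸ mem_univ y))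
    have h1 := hf.dist_le_mul x z
    rw [h0 z hz, Real.dist_eq, sub_zero, ← hxz] at h1
    exact h1.trans (mul_le_mul_of_nonneg_left (Metric.infDist_le_dist_of_mem hy) K.2)
  refine LipschitzWith.of_dist_le_mul fun x y => ?_
  by_cases hx : x ∈ U <;> by_cases hy : y ∈ U
  · simpa [hx, hy] using hf.dist_le_mul x y
  · simpa [hx, hy, Real.dist_eq] using key x hx y hy
  · rw [dist_comm x y]
    simpa [hx, hy, Real.dist_eq] using key y hy x hx
  · simp only [indicator_of_notMem, hx, hy, not_false_eq_true, dist_self]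
    positivity

lemma exists_lipschitz_zero_one {S T : Set Plane} (hS : IsCompact S) (hT : IsClosed T)
    (h : Disjoint S T) : ∃ (f : Plane → ℝ) (K : ℝ≥0), LipschitzWith K f ∧ (∀ x ∈ S, f x = 1) ∧
      (∀ x ∈ T, f x = 0) ∧ ∀ x, f x ∈ Icc (0 : ℝ) 1 := by
  obtain ⟨δ, hδ, hd⟩ := h.exists_thickenings hS hT
  refine ⟨fun x => (thickenedIndicator hδ S x : ℝ), _,
    (LipschitzWith.subtype_val _).comp (lipschitzWith_thickenedIndicator hδ S), fun x hx => ?_,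
    fun x hx => ?_, fun x => ⟨NNReal.coe_nonneg _, ?_⟩⟩
  · simp [thickenedIndicator_one hδ S hx]
  · have : x ∉ Metric.thickening δ S :=
      fun h' => (disjoint_left.1 hd h') (Metric.self_subset_thickening hδ T hx)
    simp [thickenedIndicator_zero hδ S this]
  · exact_mod_cast thickenedIndicator_le_one hδ S x

lemma exists_lipschitz_three_values {A B D : Set Plane} (hA : IsClosed A) (hB : IsCompact B)
    (hD : IsCompact D) (hAB : Disjoint A B) (hAD : Disjoint A D) (hBD : Disjoint B D)
    {t : ℝ} (ht : t ∈ Icc (0 : ℝ) 1) :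
    ∃ (f : Plane → ℝ) (K : ℝ≥0), LipschitzWith K f ∧ (∀ x ∈ A, f x = 0) ∧ (∀ x ∈ B, f x = 1) ∧
      (∀ x ∈ D, f x = t) ∧ ∀ x, f x ∈ Icc (0 : ℝ) 1 := by
  obtain ⟨f, K, hf, f1, f0, fI⟩ := exists_lipschitz_zero_one hB (hA.union hD.isClosed)
    (disjoint_union_right.2 ⟨hAB.symm, hBD⟩)
  obtain ⟨g, L, hg, g1, g0, gI⟩ := exists_lipschitz_zero_one hD hA hAD.symm
  have hle : ∀ x, t * g x ≤ 1 := fun x => mul_le_one₀ ht.2 (gI x).1 (gI x).2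
  refine ⟨fun x => max (f x) (t * g x), _, hf.max ((lipschitzWith_smul t).comp hg),
    fun x hx => ?_, fun x hx => ?_, fun x hx => ?_, fun x => ⟨?_, ?_⟩⟩
  · simp [f0 x (Or.inl hx), g0 x hx]
  · simp [f1 x hx, hle x]
  · simp [f0 x (Or.inr hx), g1 x hx, ht.1]
  · exact le_max_of_le_left (fI x).1
  · exact max_le (fI x).2 (hle x)

/-! ### A criterion for membership in the kernel -/

lemma LipschitzWith.mul_of_bounded {f g : Plane → ℝ} {K L M N : ℝ≥0} (hf : LipschitzWith K f)
    (hg : LipschitzWith L g) (hM : ∀ x, |f x| ≤ M) (hN : ∀ x, |g x| ≤ N) :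
    LipschitzWith (M * L + N * K) (fun x => f x * g x) := by
  refine LipschitzWith.of_dist_le_mul fun x y => ?_
  have h1 := hf.dist_le_mul x y
  have h2 := hg.dist_le_mul x y
  rw [Real.dist_eq] at h1 h2 ⊢
  have e : f x * g x - f y * g y = f x * (g x - g y) + g y * (f x - f y) := by ring
  rw [e]
  refine (abs_add_le _ _).trans ?_
  rw [abs_mul, abs_mul]
  push_cast
  have h3 := mul_le_mul (hM x) h2 (abs_nonneg _) M.2
  have h4 := mul_le_mul (hN y) h1 (abs_nonneg _) N.2
  calc _ ≤ _ := add_le_add h3 h4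
    _ = _ := by ring

lemma gradient_mul {f g : Plane → ℝ} {x : Plane} (hf : DifferentiableAt ℝ f x)
    (hg : DifferentiableAt ℝ g x) :
    ∇ (fun z => f z * g z) x = f x • ∇ g x + g x • ∇ f x := by
  simp only [gradient, fderiv_fun_mul hf hg, map_add, map_smul]

lemma bracket_add_right (p q r : Plane) : bracket p (q + r) = bracket p q + bracket p r := by
  simp only [bracket, PiLp.add_apply]; ring

lemma bracket_smul_right (p q : Plane) (c : ℝ) : bracket p (c • q) = c * bracket p q := by
  simp only [bracket, PiLp.smul_apply, smul_eq_mul]; ring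

lemma bracket_swap (p q : Plane) : bracket p q = -bracket q p := by
  simp only [bracket]; ring

lemma bracket_zero_left (q : Plane) : bracket 0 q = 0 := by simp [bracket]

lemma HasCompactSupport.exists_abs_le {φ : Plane → ℝ} (hc : HasCompactSupport φ)
    (hφ : Continuous φ) : ∃ M : ℝ≥0, ∀ x, |φ x| ≤ M := by
  obtain ⟨C, hC⟩ := hc.exists_bound_of_continuous hφ
  exact ⟨C.toNNReal, fun x => (hC x).trans (Real.le_coe_toNNReal C)⟩

/-- The identity `∫ w {χ, φ} = ∫ χ {φ, w}` moves the derivative from `χ` to `w`. -/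
lemma integral_mul_bracket_eq {φ χ w : Plane → ℝ} (hφ : ContDiff ℝ (⊤ : ℕ∞) φ)
    (hφc : HasCompactSupport φ) (hχ : ContDiff ℝ (⊤ : ℕ∞) χ) (hχc : HasCompactSupport χ)
    {K M : ℝ≥0} (hw : LipschitzWith K w) (hM : ∀ x, |w x| ≤ M) :
    ∫ x, w x * bracket (∇ χ x) (∇ φ x) = ∫ x, χ x * bracket (∇ φ x) (∇ w x) := by
  obtain ⟨D, hD⟩ := ContDiff.lipschitzWith_of_hasCompactSupport hχc hχ (by simp)
  obtain ⟨N, hN⟩ := hχc.exists_abs_le hχ.continuous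
  have h0 := integral_bracket_gradient_eq_zero hφ hφc (hw.mul_of_bounded hD hM hN)
  have i1 : Integrable (fun x => w x * bracket (∇ φ x) (∇ χ x)) :=
    (integrable_bracket_gradient hφ hφc hD).bdd_mul hw.continuous.aestronglyMeasurable
      (Eventually.of_forall hM)
  have i2 : Integrable (fun x => χ x * bracket (∇ φ x) (∇ w x)) :=
    (integrable_bracket_gradient hφ hφc hw).bdd_mul hχ.continuous.aestronglyMeasurable
      (Eventually.of_forall hN)
  have e : ∫ x, bracket (∇ φ x) (∇ (fun z => w z * χ z) x) =
      ∫ x, (w x * bracket (∇ φ x) (∇ χ x) + χ x * bracket (∇ φ x) (∇ w x)) := by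
    refine integral_congr_ae ?_
    filter_upwards [hw.ae_differentiableAt] with x hx
    rw [gradient_mul hx (hχ.differentiable (by simp) x), bracket_add_right, bracket_smul_right,
      bracket_smul_right]
  rw [e, integral_add i1 i2] at h0
  simp_rw [fun x => bracket_swap (∇ χ x) (∇ φ x), mul_neg, integral_neg]
  linarith

lemma IsTestFunction.gradient_eq_zero {Ω : Set Plane} {φ : Plane → ℝ} (hφ : IsTestFunction Ω φ)
    {x : Plane} (hx : x ∉ Ω) : ∇ φ x = 0 := by
  have : x ∉ tsupport (fderiv ℝ φ) := fun h => hx (hφ.tsupport_subset (tsupport_fderiv_subset ℝ h))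
  rw [gradient, image_eq_zero_of_notMem_tsupport this, map_zero]

lemma IsTestFunction.memLp {Ω : Set Plane} {φ : Plane → ℝ} (hφ : IsTestFunction Ω φ) :
    MemLp φ 2 (volume.restrict Ω) :=
  (hφ.smooth.continuous.memLp_of_hasCompactSupport hφ.hasCompactSupport).restrict Ω

lemma IsTestFunction.memLp_gradient {Ω : Set Plane} {φ : Plane → ℝ} (hφ : IsTestFunction Ω φ) :
    MemLp (∇ φ) 2 (volume.restrict Ω) := by
  have hc : HasCompactSupport (∇ φ) :=
    (hφ.hasCompactSupport.fderiv ℝ).comp_left (map_zero (InnerProductSpace.toDual ℝ Plane).symm)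
  have hcont : Continuous (∇ φ) := (InnerProductSpace.toDual ℝ Plane).symm.continuous.comp
    (hφ.smooth.continuous_fderiv (by simp))
  exact (hcont.memLp_of_hasCompactSupport hc).restrict Ω

/-- A property that is closed in `H¹₀(Ω)` holds everywhere if it holds for test functions. -/
lemma H10.induction_test {Ω : Set Plane} {P : H10 Ω → Prop} (hP : IsClosed {u | P u})
    (h : ∀ (u : H10 Ω) (φ : Plane → ℝ), IsTestFunction Ω φ → u.fn =ᵐ[volume.restrict Ω] φ →
      u.grad =ᵐ[volume.restrict Ω] ∇ φ → P u) (u : H10 Ω) : P u := by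
  have hd : DenseRange (Set.inclusion (testPairs Ω).le_topologicalClosure) :=
    (denseRange_inclusion_iff (testPairs Ω).le_topologicalClosure).2 le_rfl
  refine hd.induction_on u hP ?_
  rintro ⟨p, φ, hφ, h1, h2⟩
  exact h _ φ hφ h1 h2

lemma memLp_bracket_gradient {Ω : Set Plane} {φ w : Plane → ℝ} (hφ : IsTestFunction Ω φ)
    {K : ℝ≥0} (hw : LipschitzWith K w) :
    MemLp (fun x => bracket (∇ φ x) (∇ w x)) 2 (volume.restrict Ω) := by
  have hb : Continuous fun z : Plane × Plane => bracket z.1 z.2 := by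
    unfold bracket; fun_prop
  refine (hφ.memLp_gradient.norm.mul_const (K : ℝ)).mono (hb.comp_aestronglyMeasurable
    (aestronglyMeasurable_gradient.prodMk aestronglyMeasurable_gradient))
    (Eventually.of_forall fun x => ?_)
  rw [Real.norm_eq_abs, Real.norm_eq_abs]
  exact (abs_bracket_le _ _).trans
    ((mul_le_mul_of_nonneg_left (norm_gradient_le hw x) (norm_nonneg _)).trans (le_abs_self _))

/-- Against a test function, the weak Poisson operator can be written without derivatives
of `ψ`. -/
lemma poissonOp_apply_test {Ω : Set Plane} (hΩ : IsOpen Ω) (hb : Bornology.IsBounded Ω)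
    {ω w : Plane → ℝ} (hω : ContinuousOn ω (closure Ω)) {K M : ℝ≥0} (hw : LipschitzWith K w)
    (hM : ∀ x, |w x| ≤ M) (hωw : ∀ x ∈ Ω, ω x = w x) (ψ Φ : H10 Ω) {φ : Plane → ℝ}
    (hφ : IsTestFunction Ω φ) (hΦ : Φ.grad =ᵐ[volume.restrict Ω] ∇ φ) :
    poissonOp Ω hb ω hω ψ Φ = ∫ x in Ω, ψ.fn x * bracket (∇ φ x) (∇ w x) := by
  have hL := memLp_bracket_gradient hφ hw
  have hint : ∀ u : H10 Ω, ∫ x in Ω, u.fn x * bracket (∇ φ x) (∇ w x) =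
      inner ℝ (hL.toLp) (u : FunGrad Ω).fst := by
    intro u
    rw [L2.inner_def]
    refine integral_congr_ae ?_
    filter_upwards [hL.coeFn_toLp] with x hx
    simp [hx, H10.fn]
  refine H10.induction_test (P := fun ψ => poissonOp Ω hb ω hω ψ Φ =
    ∫ x in Ω, ψ.fn x * bracket (∇ φ x) (∇ w x)) ?_ ?_ ψ
  · simp_rw [hint]
    refine isClosed_eq ?_ ?_
    · exact (ContinuousLinearMap.apply ℝ ℝ Φ).continuous.comp (poissonOp Ω hb ω hω).continuous
    · exact continuous_const.inner
        ((WithLp.prod_continuous_ofLp 2 _ _).fst.comp continuous_subtype_val)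
  · intro u χ hχ h1 h2
    rw [poissonOp_apply]
    have e1 : ∫ x in Ω, ω x * bracket (u.grad x) (Φ.grad x) =
        ∫ x in Ω, w x * bracket (∇ χ x) (∇ φ x) := by
      refine integral_congr_ae ?_
      filter_upwards [h2, hΦ, ae_restrict_mem hΩ.measurableSet] with x hx hx' hxΩ
      rw [hx, hx', hωw x hxΩ]
    have e2 : ∫ x in Ω, u.fn x * bracket (∇ φ x) (∇ w x) =
        ∫ x in Ω, χ x * bracket (∇ φ x) (∇ w x) := by
      refine integral_congr_ae ?_
      filter_upwards [h1] with x hx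
      rw [hx]
    rw [e1, e2, setIntegral_eq_integral_of_forall_compl_eq_zero,
      setIntegral_eq_integral_of_forall_compl_eq_zero,
      integral_mul_bracket_eq hφ.smooth hφ.hasCompactSupport hχ.smooth hχ.hasCompactSupport hw hM]
    · intro x hx
      rw [hφ.gradient_eq_zero hx, bracket_zero_left, mul_zero]
    · intro x hx
      rw [hχ.gradient_eq_zero hx, bracket_zero_left, mul_zero]

/-- If `ψ ∇ω` is the gradient of a Lipschitz function `H`, then `ψ` lies in the kernel. -/
lemma mem_ker_poissonOp {Ω : Set Plane} (hΩ : IsOpen Ω) (hb : Bornology.IsBounded Ω)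
    {ω w : Plane → ℝ} (hω : ContinuousOn ω (closure Ω)) {K M : ℝ≥0} (hw : LipschitzWith K w)
    (hM : ∀ x, |w x| ≤ M) (hωw : ∀ x ∈ Ω, ω x = w x) (ψ : H10 Ω) {H : Plane → ℝ} {L : ℝ≥0}
    (hH : LipschitzWith L H) (h : ∀ᵐ x ∂(volume.restrict Ω), ∇ H x = ψ.fn x • ∇ w x) :
    ψ ∈ (poissonOp Ω hb ω hω).ker := by
  rw [LinearMap.mem_ker]
  refine ContinuousLinearMap.ext fun Φ => ?_
  refine H10.induction_test (P := fun Φ => poissonOp Ω hb ω hω ψ Φ = 0) ?_ ?_ Φ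
  · exact isClosed_eq (poissonOp Ω hb ω hω ψ).continuous continuous_const
  · intro u φ hφ _ hu
    rw [poissonOp_apply_test hΩ hb hω hw hM hωw ψ u hφ hu,
      ← integral_bracket_gradient_eq_zero hφ.smooth hφ.hasCompactSupport hH,
      ← setIntegral_eq_integral_of_forall_compl_eq_zero (s := Ω)
        (f := fun x => bracket (∇ φ x) (∇ H x))]
    · refine integral_congr_ae ?_
      filter_upwards [h] with x hx
      rw [hx, bracket_smul_right]
    · intro x hx
      rw [hφ.gradient_eq_zero hx, bracket_zero_left]

/-! ### Lipschitz functions in `H¹₀(Ω)` -/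

/-- Some element of `H¹₀(Ω)` is almost everywhere equal to `f` on `Ω` and has weak gradient `G`. -/
def RepresentsH10 (Ω : Set Plane) (f : Plane → ℝ) (G : Plane → Plane) : Prop :=
  ∃ u : H10 Ω, u.fn =ᵐ[volume.restrict Ω] f ∧ u.grad =ᵐ[volume.restrict Ω] G

lemma IsTestFunction.representsH10 {Ω : Set Plane} {φ : Plane → ℝ} (hφ : IsTestFunction Ω φ) :
    RepresentsH10 Ω φ (∇ φ) :=
  ⟨⟨WithLp.toLp 2 (hφ.memLp.toLp, hφ.memLp_gradient.toLp),
    (testPairs Ω).le_topologicalClosure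
      ⟨φ, hφ, hφ.memLp.coeFn_toLp, hφ.memLp_gradient.coeFn_toLp⟩⟩,
    hφ.memLp.coeFn_toLp, hφ.memLp_gradient.coeFn_toLp⟩

/-- Bounded convergence in `L²`. -/
lemma tendsto_Lp_two_of_bounded {E : Type*} [NormedAddCommGroup E] {μ : Measure Plane}
    [IsFiniteMeasure μ] {u : ℕ → Lp E 2 μ} {a : Lp E 2 μ} {C : ℝ}
    (hC : ∀ n, ∀ᵐ x ∂μ, ‖u n x‖ ≤ C)
    (h : ∀ᵐ x ∂μ, Tendsto (fun n => u n x) atTop (𝓝 (a x))) : Tendsto u atTop (𝓝 a) := by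
  rw [Lp.tendsto_Lp_iff_tendsto_eLpNorm']
  simp_rw [eLpNorm_eq_lintegral_rpow_enorm_toReal (p := 2) (by simp) (by simp)]
  have key : Tendsto (fun n => ∫⁻ x, ‖(u n - a : Plane → E) x‖ₑ ^ (2 : ENNReal).toReal ∂μ) atTop
      (𝓝 (∫⁻ _, 0 ∂μ)) := by
    refine tendsto_lintegral_of_dominated_convergence'
      (fun _ => ENNReal.ofReal (C + C) ^ (2 : ENNReal).toReal) (fun n => ?_) (fun n => ?_) ?_ ?_
    · exact ((Lp.aestronglyMeasurable (u n)).sub (Lp.aestronglyMeasurable a)).enorm.pow_const _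
    · filter_upwards [ae_all_iff.2 hC, h] with x hx hlim
      have ha : ‖a x‖ ≤ C := le_of_tendsto hlim.norm (Eventually.of_forall hx)
      refine ENNReal.rpow_le_rpow ?_ (by positivity)
      rw [← ofReal_norm]
      exact ENNReal.ofReal_le_ofReal ((norm_sub_le _ _).trans (add_le_add (hx n) ha))
    · rw [lintegral_const]
      exact ENNReal.mul_ne_top (ENNReal.rpow_ne_top_of_nonneg (by positivity)
        ENNReal.ofReal_ne_top) (measure_ne_top μ _)
    · filter_upwards [h] with x hx
      have h1 : Tendsto (fun n => ‖(u n - a : Plane → E) x‖ₑ) atTop (𝓝 0) := by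
        have := (hx.sub_const (a x)).enorm
        simpa using this
      have := h1.ennrpow_const (2 : ENNReal).toReal
      simpa using this
  have := key.ennrpow_const (1 / (2 : ENNReal).toReal)
  simpa using this

/-- Bounded almost everywhere convergence of functions and gradients preserves `H¹₀(Ω)`. -/
lemma RepresentsH10.of_tendsto {Ω : Set Plane} (hb : Bornology.IsBounded Ω)
    {f : ℕ → Plane → ℝ} {G : ℕ → Plane → Plane} (h : ∀ n, RepresentsH10 Ω (f n) (G n))
    {f' : Plane → ℝ} {G' : Plane → Plane} {C : ℝ} (hf : ∀ n x, |f n x| ≤ C)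
    (hG : ∀ n x, ‖G n x‖ ≤ C)
    (hlim : ∀ᵐ x ∂(volume.restrict Ω), Tendsto (fun n => f n x) atTop (𝓝 (f' x)))
    (hlim' : ∀ᵐ x ∂(volume.restrict Ω), Tendsto (fun n => G n x) atTop (𝓝 (G' x))) :
    RepresentsH10 Ω f' G' := by
  have : IsFiniteMeasure (volume.restrict Ω) := ⟨by
    simpa using hb.measure_lt_top⟩
  choose u hu hu' using h
  have hm : MemLp f' 2 (volume.restrict Ω) := by
    refine MemLp.of_bound (aestronglyMeasurable_of_tendsto_ae atTop (fun n =>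
      (Lp.aestronglyMeasurable (u n : FunGrad Ω).fst).congr (hu n)) hlim) C ?_
    filter_upwards [hlim] with x hx
    exact le_of_tendsto hx.norm (Eventually.of_forall fun n => hf n x)
  have hm' : MemLp G' 2 (volume.restrict Ω) := by
    refine MemLp.of_bound (aestronglyMeasurable_of_tendsto_ae atTop (fun n =>
      (Lp.aestronglyMeasurable (u n : FunGrad Ω).snd).congr (hu' n)) hlim') C ?_
    filter_upwards [hlim'] with x hx
    exact le_of_tendsto hx.norm (Eventually.of_forall fun n => hG n x)
  have t1 : Tendsto (fun n => (u n : FunGrad Ω).fst) atTop (𝓝 hm.toLp) := by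
    refine tendsto_Lp_two_of_bounded (C := C) (fun n => ?_) ?_
    · filter_upwards [hu n] with x hx
      rw [show (u n : FunGrad Ω).fst x = f n x from hx]
      exact hf n x
    · filter_upwards [ae_all_iff.2 hu, hlim, hm.coeFn_toLp] with x hx hl hm
      rw [hm]
      exact hl.congr fun n => (hx n).symm
  have t2 : Tendsto (fun n => (u n : FunGrad Ω).snd) atTop (𝓝 hm'.toLp) := by
    refine tendsto_Lp_two_of_bounded (C := C) (fun n => ?_) ?_
    · filter_upwards [hu' n] with x hx
      rw [show (u n : FunGrad Ω).snd x = G n x from hx]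
      exact hG n x
    · filter_upwards [ae_all_iff.2 hu', hlim', hm'.coeFn_toLp] with x hx hl hm
      rw [hm]
      exact hl.congr fun n => (hx n).symm
  have t : Tendsto (fun n => (u n : FunGrad Ω)) atTop (𝓝 (WithLp.toLp 2 (hm.toLp, hm'.toLp))) :=
    ((WithLp.prod_continuous_toLp 2 _ _).tendsto _).comp (t1.prodMk_nhds t2)
  exact ⟨⟨_, (testPairs Ω).isClosed_topologicalClosure.mem_of_tendsto t
    (Eventually.of_forall fun n => (u n).2)⟩, hm.coeFn_toLp, hm'.coeFn_toLp⟩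

/-! ### Mollification of Lipschitz functions -/

section Mollification

open ContinuousLinearMap (lsmul)
open scoped Convolution

lemma lipschitzWith_convolution {f : Plane → ℝ} {K : ℝ≥0} (hf : LipschitzWith K f)
    (ρ : ContDiffBump (0 : Plane)) :
    LipschitzWith K (ρ.normed volume ⋆[lsmul ℝ ℝ, volume] f) := by
  have hint : ∀ x, Integrable (fun t => ρ.normed volume t * f (x - t)) := fun x =>
    ((ρ.continuous_normed (μ := volume)).mul (hf.continuous.comp
      (continuous_const.sub continuous_id))).integrable_of_hasCompactSupport
      (ρ.hasCompactSupport_normed (μ := volume)).mul_right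
  refine LipschitzWith.of_dist_le_mul fun x y => ?_
  simp only [convolution_def, ContinuousLinearMap.lsmul_apply, smul_eq_mul]
  rw [dist_eq_norm, ← integral_sub (hint x) (hint y)]
  calc ‖∫ t, (ρ.normed volume t * f (x - t) - ρ.normed volume t * f (y - t))‖
      ≤ ∫ t, ρ.normed volume t * (K * dist x y) := by
        refine norm_integral_le_of_norm_le ((ρ.integrable_normed (μ := volume)).mul_const _)
          (Eventually.of_forall fun t => ?_)
        rw [← mul_sub, norm_mul, Real.norm_of_nonneg (ρ.nonneg_normed t)]
        refine mul_le_mul_of_nonneg_left ?_ (ρ.nonneg_normed t)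
        have := hf.dist_le_mul (x - t) (y - t)
        rwa [dist_sub_right, dist_eq_norm] at this
    _ = K * dist x y := by rw [integral_mul_const, ρ.integral_normed, one_mul]

lemma abs_convolution_le {f : Plane → ℝ} {M : ℝ} (hM : ∀ x, |f x| ≤ M)
    (ρ : ContDiffBump (0 : Plane)) (x : Plane) :
    |(ρ.normed volume ⋆[lsmul ℝ ℝ, volume] f) x| ≤ M := by
  simp only [convolution_def, ContinuousLinearMap.lsmul_apply, smul_eq_mul]
  calc |∫ t, ρ.normed volume t * f (x - t)| ≤ ∫ t, ρ.normed volume t * M := by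
        rw [← Real.norm_eq_abs]
        refine norm_integral_le_of_norm_le ((ρ.integrable_normed (μ := volume)).mul_const _)
          (Eventually.of_forall fun t => ?_)
        rw [norm_mul, Real.norm_of_nonneg (ρ.nonneg_normed t)]
        exact mul_le_mul_of_nonneg_left (hM _) (ρ.nonneg_normed t)
    _ = M := by rw [integral_mul_const, ρ.integral_normed, one_mul]

/-- The derivative of a mollification of `f` is the mollification of the derivative of `f`. -/
lemma fderiv_convolution_apply {f : Plane → ℝ} {K : ℝ≥0} (hf : LipschitzWith K f)
    (ρ : ContDiffBump (0 : Plane)) (x v : Plane) :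
    fderiv ℝ (ρ.normed volume ⋆[lsmul ℝ ℝ, volume] f) x v =
      (ρ.normed volume ⋆[lsmul ℝ ℝ, volume] fun y => lineDeriv ℝ f y v) x := by
  have hs : ContDiff ℝ (1 : ℕ∞) (ρ.normed volume) := ρ.contDiff_normed
  rw [(ρ.hasCompactSupport_normed.hasFDerivAt_convolution_left (lsmul ℝ ℝ) hs
    hf.continuous.locallyIntegrable x).fderiv]
  have hex : ConvolutionExistsAt (fderiv ℝ (ρ.normed volume)) f x
      ((lsmul ℝ ℝ : ℝ →L[ℝ] ℝ →L[ℝ] ℝ).precompL Plane) volume :=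
    (ρ.hasCompactSupport_normed.fderiv ℝ).convolutionExists_left _
      (hs.continuous_fderiv (by simp)) hf.continuous.locallyIntegrable x
  simp only [convolution_def]
  rw [ContinuousLinearMap.integral_apply hex]
  simp only [ContinuousLinearMap.precompL_apply, ContinuousLinearMap.lsmul_apply, smul_eq_mul]
  have hfx : LipschitzWith (K * 1) (fun t => f (x - t)) :=
    hf.comp (LipschitzWith.of_dist_le_mul fun a b => by
      rw [dist_sub_left, NNReal.coe_one, one_mul])
  obtain ⟨D, hD⟩ := ContDiff.lipschitzWith_of_hasCompactSupport ρ.hasCompactSupport_normed hs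
    (by simp)
  have h := hfx.integral_lineDeriv_mul_eq (μ := volume) hD ρ.hasCompactSupport_normed (-v)
  rw [neg_neg] at h
  have e1 : ∀ t, lineDeriv ℝ (ρ.normed volume) t v = fderiv ℝ (ρ.normed volume) t v := fun t =>
    (hs.differentiable (by simp) t).lineDeriv_eq_fderiv
  have e2 : ∀ t, lineDeriv ℝ (fun t => f (x - t)) t (-v) = lineDeriv ℝ f (x - t) v := by
    intro t
    simp only [lineDeriv]
    congr 1
    ext s
    congr 1
    module
  simp only [e1, e2] at h
  rw [← h]
  exact integral_congr_ae (Eventually.of_forall fun t => mul_comm _ _)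

lemma tendsto_gradient_iff {l : Filter ℕ} {f : ℕ → Plane} {a : Plane} :
    Tendsto f l (𝓝 a) ↔ ∀ i, Tendsto (fun n => f n i) l (𝓝 (a i)) := by
  rw [(EuclideanSpace.equiv (Fin 2) ℝ).toHomeomorph.isInducing.tendsto_nhds_iff, tendsto_pi_nhds]
  rfl

/-- A Lipschitz function with compact support in `Ω` belongs to `H¹₀(Ω)`, by mollification. -/
lemma LipschitzWith.representsH10_of_hasCompactSupport {Ω : Set Plane} (hΩ : IsOpen Ω)
    (hb : Bornology.IsBounded Ω) {f : Plane → ℝ} {K : ℝ≥0} (hf : LipschitzWith K f)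
    (hc : HasCompactSupport f) (hs : tsupport f ⊆ Ω) : RepresentsH10 Ω f (∇ f) := by
  obtain ⟨δ, hδ, hδΩ⟩ := hc.isCompact.exists_cthickening_subset_open hΩ hs
  obtain ⟨M, hM⟩ := hc.exists_abs_le hf.continuous
  -- mollifiers supported within distance `δ`; the ratio `2` of the radii is what the almost
  -- everywhere convergence of the mollified gradient needs
  let ρ : ℕ → ContDiffBump (0 : Plane) := fun n =>
    ⟨δ / (n + 1) / 2, δ / (n + 1), by positivity, half_lt_self (by positivity)⟩
  have hr : Tendsto (fun n => (ρ n).rOut) atTop (𝓝 0) := by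
    have := (tendsto_one_div_add_atTop_nhds_zero_nat (𝕜 := ℝ)).const_mul δ
    simpa [ρ, div_eq_mul_inv] using this
  have hrK : ∀ᶠ n in atTop, (ρ n).rOut ≤ 2 * (ρ n).rIn :=
    Eventually.of_forall fun n => by simp only [ρ]; linarith
  have hrδ : ∀ n, (ρ n).rOut ≤ δ := fun n =>
    div_le_self hδ.le (by linarith [n.cast_nonneg (α := ℝ)])
  set F : ℕ → Plane → ℝ := fun n => (ρ n).normed volume ⋆[lsmul ℝ ℝ, volume] f with hF
  have hsupp : ∀ n, tsupport (F n) ⊆ Metric.cthickening δ (tsupport f) := by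
    intro n
    refine closure_minimal ?_ Metric.isClosed_cthickening
    refine (support_convolution_subset _).trans ?_
    rw [(ρ n).support_normed_eq]
    rintro _ ⟨a, ha, b, hb, rfl⟩
    refine Metric.mem_cthickening_of_dist_le _ b δ _ (subset_tsupport f hb) ?_
    rw [mem_ball_zero_iff] at ha
    simpa using ha.le.trans (hrδ n)
  have htest : ∀ n, IsTestFunction Ω (F n) := fun n =>
    ⟨(ρ n).hasCompactSupport_normed.contDiff_convolution_left _ (ρ n).contDiff_normed
      hf.continuous.locallyIntegrable,
      hc.isCompact.cthickening.of_isClosed_subset (isClosed_tsupport _) (hsupp n),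
      (hsupp n).trans hδΩ⟩
  refine RepresentsH10.of_tendsto hb (C := max M K) (fun n => (htest n).representsH10)
    (fun n x => le_max_of_le_left (abs_convolution_le hM (ρ n) x))
    (fun n x => le_max_of_le_right (norm_gradient_le (lipschitzWith_convolution hf (ρ n)) x))
    (Eventually.of_forall fun x =>
      ContDiffBump.convolution_tendsto_right_of_continuous hr hf.continuous x) ?_
  have hae : ∀ i : Fin 2, ∀ᵐ x : Plane, Tendsto (fun n => ∇ (F n) x i) atTop
      (𝓝 (lineDeriv ℝ f x (EuclideanSpace.single i 1))) := by
    intro i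
    filter_upwards [ContDiffBump.ae_convolution_tendsto_right_of_locallyIntegrable (μ := volume)
      hr hrK (hf.locallyIntegrable_lineDeriv (EuclideanSpace.single i 1))] with x hx
    refine hx.congr fun n => ?_
    rw [gradient_apply_eq_fderiv, fderiv_convolution_apply hf]
  refine ae_restrict_of_ae ?_
  filter_upwards [ae_all_iff.2 hae, hf.ae_differentiableAt] with x hx hd
  refine tendsto_gradient_iff.2 fun i => ?_
  rw [gradient_apply_eq_fderiv, ← hd.lineDeriv_eq_fderiv]
  exact hx i

end Mollification

/-- A Lipschitz function vanishing off the bounded open set `Ω` belongs to `H¹₀(Ω)`: it is the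
limit of the truncations `(f - ε)₊ - (-f - ε)₊`, which have compact support in `Ω`. -/
lemma LipschitzWith.representsH10 {Ω : Set Plane} (hΩ : IsOpen Ω)
    (hb : Bornology.IsBounded Ω) {f : Plane → ℝ} {K : ℝ≥0} (hf : LipschitzWith K f)
    (h0 : ∀ x ∉ Ω, f x = 0) : RepresentsH10 Ω f (∇ f) := by
  have hzero : ∀ ε s : ℝ, |s| ≤ ε → max (s - ε) 0 - max (-s - ε) 0 = 0 := by
    intro ε s hs
    rw [abs_le] at hs
    rw [max_eq_right (by linarith), max_eq_right (by linarith), sub_zero]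
  set T : ℕ → Plane → ℝ := fun n x => max (f x - 1 / ((n : ℝ) + 1)) 0 -
    max (-f x - 1 / ((n : ℝ) + 1)) 0 with hT
  have hε : ∀ n : ℕ, 0 < 1 / ((n : ℝ) + 1) := fun n => by positivity
  have hlip : ∀ n, LipschitzWith (K + K) (T n) := by
    intro n
    refine LipschitzWith.sub ?_ ?_
    · exact LipschitzWith.max_const (by simpa using hf.sub (LipschitzWith.const _)) 0
    · exact LipschitzWith.max_const (by simpa using hf.neg.sub (LipschitzWith.const _)) 0
  have hsub : ∀ n, tsupport (T n) ⊆ {x | 1 / ((n : ℝ) + 1) ≤ |f x|} := by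
    intro n
    refine closure_minimal (fun x hx => ?_) (isClosed_le continuous_const hf.continuous.abs)
    by_contra hlt
    exact hx (hzero _ _ (not_le.1 hlt).le)
  have hsubΩ : ∀ n, tsupport (T n) ⊆ Ω := by
    intro n x hx
    by_contra hxΩ
    have h1 : 1 / ((n : ℝ) + 1) ≤ |f x| := hsub n hx
    rw [h0 x hxΩ, abs_zero] at h1
    exact absurd h1 (not_le.2 (hε n))
  have hcomp : ∀ n, HasCompactSupport (T n) := fun n =>
    Metric.isCompact_of_isClosed_isBounded (isClosed_tsupport _) (hb.subset (hsubΩ n))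
  obtain ⟨M, hM⟩ : ∃ M : ℝ≥0, ∀ x, |f x| ≤ M :=
    HasCompactSupport.exists_abs_le (hb.isCompact_closure.of_isClosed_subset (isClosed_tsupport f)
      (closure_mono fun x hx => by_contra fun h => hx (h0 x h))) hf.continuous
  have hlim0 : Tendsto (fun n : ℕ => 1 / ((n : ℝ) + 1)) atTop (𝓝 0) :=
    tendsto_one_div_add_atTop_nhds_zero_nat
  refine RepresentsH10.of_tendsto hb (C := max M (K + K : ℝ≥0))
    (fun n => (hlip n).representsH10_of_hasCompactSupport hΩ hb (hcomp n) (hsubΩ n))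
    (fun n x => le_max_of_le_left ?_) (fun n x => le_max_of_le_right (norm_gradient_le (hlip n) x))
    (Eventually.of_forall fun x => ?_) (ae_restrict_of_ae ?_)
  · refine le_trans ?_ (hM x)
    have := (hε n).le
    simp only [hT]
    rcases le_total 0 (f x) with h | h
    · rw [abs_of_nonneg h, max_eq_right (a := -f x - _) (by linarith), sub_zero,
        abs_of_nonneg (le_max_right _ _)]
      exact max_le (by linarith) h
    · rw [abs_of_nonpos h, max_eq_right (a := f x - _) (by linarith), zero_sub, abs_neg,
        abs_of_nonneg (le_max_right _ _)]
      exact max_le (by linarith) (by linarith)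
  · have := ((hlim0.const_sub (f x)).max (tendsto_const_nhds (x := (0 : ℝ)))).sub
      ((hlim0.const_sub (-f x)).max (tendsto_const_nhds (x := (0 : ℝ))))
    simpa [hT, max_zero_sub_max_neg_zero_eq_self] using this
  · -- for large `n` the gradients agree where `f ≠ 0`; on `{f = 0}` both vanish almost everywhere
    filter_upwards [hf.ae_fderiv_eq_zero_of_eq 0] with x hx
    refine tendsto_const_nhds.congr' ?_
    rcases lt_trichotomy (f x) 0 with h | h | h
    · filter_upwards [hlim0.eventually_lt_const (neg_pos.2 h)] with n hn
      have : T n =ᶠ[𝓝 x] fun z => f z - (-(1 / ((n : ℝ) + 1))) := by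
        filter_upwards [hf.continuous.continuousAt.eventually_lt_const
          (show f x < -(1 / ((n : ℝ) + 1)) by linarith)] with z hz
        have := hε n
        simp only [hT]
        rw [max_eq_right (by linarith), max_eq_left (by linarith)]
        ring
      rw [this.gradient_eq, gradient, gradient, fderiv_sub_const]
    · refine Eventually.of_forall fun n => ?_
      have : T n =ᶠ[𝓝 x] fun _ => 0 := by
        have hc : ContinuousAt (fun z => |f z|) x := hf.continuous.abs.continuousAt
        filter_upwards [hc.eventually_lt_const (show |f x| < 1 / ((n : ℝ) + 1) by
          rw [h, abs_zero]; exact hε n)] with z hz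
        exact hzero _ _ hz.le
      beta_reduce
      rw [this.gradient_eq, gradient_fun_const, gradient, hx h, map_zero]
    · filter_upwards [hlim0.eventually_lt_const h] with n hn
      have : T n =ᶠ[𝓝 x] fun z => f z - 1 / ((n : ℝ) + 1) := by
        filter_upwards [hf.continuous.continuousAt.eventually_const_lt hn] with z hz
        have := hε n
        simp only [hT]
        rw [max_eq_left (by linarith), max_eq_right (by linarith)]
        ring
      rw [this.gradient_eq, gradient, gradient, fderiv_sub_const]

/-! ### Functions of the form `g(ω)` -/

lemma exists_lipschitzWith_sum {ι : Type*} (s : Finset ι) {f : ι → Plane → ℝ}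
    (h : ∀ l, ∃ K : ℝ≥0, LipschitzWith K (f l)) :
    ∃ K : ℝ≥0, LipschitzWith K (fun x => ∑ l ∈ s, f l x) := by
  choose K hK using h
  classical
  induction s using Finset.induction_on with
  | empty => exact ⟨0, by simp⟩
  | insert a s ha ih =>
    obtain ⟨L, hL⟩ := ih
    refine ⟨K a + L, ?_⟩
    simp_rw [Finset.sum_insert ha]
    exact (hK a).add hL

lemma exists_bounded_lipschitz_extension {Ω : Set Plane} (hb : Bornology.IsBounded Ω)
    {ω : Plane → ℝ} {K : ℝ≥0} (hω : LipschitzOnWith K ω (closure Ω)) :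
    ∃ (w : Plane → ℝ) (M : ℝ≥0), LipschitzWith K w ∧ (∀ x, |w x| ≤ M) ∧
      ∀ x ∈ closure Ω, ω x = w x := by
  obtain ⟨g, hg, he⟩ := hω.extend_real
  obtain ⟨C, hC⟩ := hb.isCompact_closure.exists_bound_of_continuousOn hω.continuousOn
  have hC0 : 0 ≤ (C.toNNReal : ℝ) := NNReal.coe_nonneg _
  refine ⟨fun x => max (-(C.toNNReal : ℝ)) (min (C.toNNReal : ℝ) (g x)), C.toNNReal,
    (hg.const_min _).const_max _, fun x => ?_, fun x hx => ?_⟩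
  · exact abs_le.2 ⟨le_max_left _ _, max_le (by linarith) (min_le_left _ _)⟩
  · have h1 : |ω x| ≤ C.toNNReal := (hC x hx).trans (Real.le_coe_toNNReal C)
    rw [he hx, abs_le] at h1
    rw [he hx]
    simp only
    rw [min_eq_right h1.2, max_eq_right h1.1]

/-- A function that is a primitive of `g` on `[-M, M]` only and is Lipschitz on all of `ℝ`. -/
lemma exists_lipschitz_primitive {g : ℝ → ℝ} {L : ℝ≥0} (hg : LipschitzWith L g) (M : ℝ≥0) :
    ∃ (P : ℝ → ℝ) (K : ℝ≥0), LipschitzWith K P ∧ ∀ s : ℝ, |s| ≤ M → HasDerivAt P (g s) s := by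
  -- the integrand is extended by its end values outside `[-M, M]`, so that it is bounded
  set c : ℝ → ℝ := fun t => g (max (-(M : ℝ)) (min (M : ℝ) t)) with hc
  have hcont : Continuous c := by
    have := hg.continuous
    fun_prop
  have hder : ∀ s, HasDerivAt (fun s => ∫ t in (0 : ℝ)..s, c t) (c s) s := fun s =>
    hcont.integral_hasStrictDerivAt 0 s |>.hasDerivAt
  have hM0 : (0 : ℝ) ≤ M := M.2
  have hbound : ∀ t, ‖c t‖ ≤ |g 0| + L * M := by
    intro t
    have h1 := hg.dist_le_mul (max (-(M : ℝ)) (min (M : ℝ) t)) 0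
    have h2 : |max (-(M : ℝ)) (min (M : ℝ) t)| ≤ M :=
      abs_le.2 ⟨le_max_left _ _, max_le (by linarith) (min_le_left _ _)⟩
    rw [Real.dist_eq, Real.dist_eq, sub_zero] at h1
    have h3 := mul_le_mul_of_nonneg_left h2 L.2
    have h4 := abs_sub_abs_le_abs_sub (c t) (g 0)
    simp only [hc, Real.norm_eq_abs, NNReal.val_eq_coe] at *
    linarith
  refine ⟨_, (|g 0| + L * M).toNNReal, lipschitzWith_of_nnnorm_deriv_le
    (fun s => (hder s).differentiableAt) fun s => ?_, fun s hs => ?_⟩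
  · rw [(hder s).deriv, ← NNReal.coe_le_coe, coe_nnnorm]
    exact (hbound s).trans (Real.le_coe_toNNReal _)
  · have h := hder s
    rw [abs_le] at hs
    rwa [show c s = g s by simp only [hc]; rw [min_eq_right hs.2, max_eq_right hs.1]] at h

/-- Every `ψ ∈ H¹₀(Ω)` of the form `g(ω)` lies in the kernel, because `ψ ∇ω` is the gradient of
`G(ω)` with `G` a primitive of `g`. -/
lemma mem_ker_of_ae_mem_filledFun {Ω : Set Plane} (hΩ : IsOpen Ω) (hb : Bornology.IsBounded Ω)
    {ω : Plane → ℝ} {K : ℝ≥0} (hω : LipschitzOnWith K ω (closure Ω)) {gL : ℝ → ℝ} {L : ℝ≥0}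
    {ν : ℕ} {α h : Fin ν → ℝ} (hgL : LipschitzWith L gL) {ψ : H10 Ω}
    (hψ : ∀ᵐ x ∂(volume.restrict Ω), ψ.fn x ∈ filledFun gL α h (ω x)) :
    ψ ∈ (poissonOp Ω hb ω hω.continuousOn).ker := by
  obtain ⟨w, M, hw, hM, hωw⟩ := exists_bounded_lipschitz_extension hb hω
  obtain ⟨P, C, hP, hPd⟩ := exists_lipschitz_primitive hgL M
  obtain ⟨D, hD⟩ := exists_lipschitzWith_sum Finset.univ
    (f := fun (l : Fin ν) x => α l * max (w x - h l) 0) fun l => by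
      have h1 : LipschitzWith K (fun x => max (w x - h l) 0) :=
        LipschitzWith.max_const (by simpa using hw.sub (LipschitzWith.const (h l))) 0
      exact ⟨_, (lipschitzWith_smul (α l)).comp h1⟩
  refine mem_ker_poissonOp hΩ hb hω.continuousOn hw hM (fun x hx => hωw x (subset_closure hx)) ψ
    ((hP.comp hw).add hD) ?_
  filter_upwards [hψ, ae_restrict_mem hΩ.measurableSet, ae_restrict_of_ae hw.ae_differentiableAt,
    ae_restrict_of_ae (ae_all_iff.2 fun l => ae_hasFDerivAt_max_sub hw (h l))] with x hx hxΩ hd hx'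
  rw [hωw x (subset_closure hxΩ)] at hx
  obtain ⟨y, hy, e⟩ := hx
  have d1 : HasFDerivAt (fun z => P (w z)) (gL (w x) • fderiv ℝ w x) x :=
    (hPd _ (hM x)).comp_hasFDerivAt x hd.hasFDerivAt
  have d2 : HasFDerivAt (fun z => ∑ l, α l * max (w z - h l) 0)
      (∑ l, α l • y l • fderiv ℝ w x) x :=
    HasFDerivAt.fun_sum fun l _ => (hx' l (y l) (hy l)).const_mul (α l)
  have d3 := d1.add d2
  have e3 : gL (w x) • fderiv ℝ w x + ∑ l, α l • y l • fderiv ℝ w x = ψ.fn x • fderiv ℝ w x := by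
    simp_rw [e, add_smul, Finset.sum_smul, mul_smul]
  rw [e3] at d3
  have : fderiv ℝ (fun z => (P ∘ w) z + ∑ l, α l * max (w z - h l) 0) x = ψ.fn x • fderiv ℝ w x :=
    d3.fderiv
  rw [gradient, this, map_smul, gradient]

/-! ### Kernel elements carried by regions bounded by a level set -/

lemma H10.ne_zero_of_fn_ae_eq {Ω : Set Plane} (hΩ : IsOpen Ω) {u : H10 Ω} {f : Plane → ℝ}
    (hf : Continuous f) (hu : u.fn =ᵐ[volume.restrict Ω] f) {x : Plane} (hx : x ∈ Ω)
    (hfx : f x ≠ 0) : u ≠ 0 := by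
  rintro rfl
  have h0 : (0 : H10 Ω).fn =ᵐ[volume.restrict Ω] fun _ => (0 : ℝ) :=
    Lp.coeFn_zero ℝ 2 (volume.restrict Ω)
  exact hfx (Measure.eqOn_open_of_ae_eq (hu.symm.trans h0) hΩ hf.continuousOn
    continuousOn_const hx)

lemma LipschitzWith.exists_gradient_eq_smul_gradient {f : Plane → ℝ} {K N : ℝ≥0}
    (hf : LipschitzWith K f) (hN : ∀ x, |f x| ≤ N) :
    ∃ (H : Plane → ℝ) (L : ℝ≥0), LipschitzWith L H ∧ ∀ᵐ x : Plane, ∇ H x = f x • ∇ f x := by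
  refine ⟨fun x => (1 / 2 : ℝ) • (f x * f x), _,
    (lipschitzWith_smul (1 / 2 : ℝ)).comp (hf.mul_of_bounded hf hN hN), ?_⟩
  filter_upwards [hf.ae_differentiableAt] with x hd
  have h1 : HasFDerivAt (fun z => (1 / 2 : ℝ) • (f z * f z))
      ((1 / 2 : ℝ) • (f x • fderiv ℝ f x + f x • fderiv ℝ f x)) x :=
    (hd.hasFDerivAt.mul hd.hasFDerivAt).const_smul (1 / 2 : ℝ)
  rw [← two_smul ℝ (f x • fderiv ℝ f x), smul_smul, one_div, inv_mul_cancel₀ two_ne_zero,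
    one_smul] at h1
  rw [gradient, one_div, h1.fderiv, map_smul, gradient]

/-- On a region where `ω` has constant height `c`, the function `g = Y(· - c)` allows every element
of `H¹₀(U)` with values in `[0, 1]`. -/
lemma exists_ker_of_eq_const {Ω : Set Plane} (hΩ : IsOpen Ω)
    (hb : Bornology.IsBounded Ω) {ω : Plane → ℝ} {K : ℝ≥0} (hω : LipschitzOnWith K ω (closure Ω))
    {U : Set Plane} (hUo : IsOpen U) (hUΩ : U ⊆ Ω) {c : ℝ} (hc : ∀ x ∈ frontier U, ω x = c)
    (hne : U.Nonempty) (hconst : ∀ x ∈ U, ω x = c) :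
    ∃ (gL : ℝ → ℝ) (L : ℝ≥0) (ν : ℕ) (α h : Fin ν → ℝ) (ψ : H10 Ω),
        LipschitzWith L gL ∧
        (∀ l, IsPlateauHeight U ω (h l)) ∧
        (∀ x ∈ frontier U, 0 ∈ filledFun gL α h (ω x)) ∧
        (∀ᵐ x ∂(volume.restrict Ω),
          (x ∈ U → ψ.fn x ∈ filledFun gL α h (ω x)) ∧ (x ∉ U → ψ.fn x = 0)) ∧
        ψ ∈ (poissonOp Ω hb ω hω.continuousOn).ker ∧ ψ ≠ 0 := by
  obtain ⟨w, M, hw, hM, hωw⟩ := exists_bounded_lipschitz_extension hb hω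
  have hωw' : ∀ x ∈ Ω, ω x = w x := fun x hx => hωw x (subset_closure hx)
  obtain ⟨f, hf⟩ : ∃ f : Plane → ℝ, f = fun x => min 1 (Metric.infDist x Uᶜ) := ⟨_, rfl⟩
  have hlip : LipschitzWith 1 f := hf ▸ (Metric.lipschitz_infDist_pt Uᶜ).const_min 1
  have hUne : Uᶜ.Nonempty := by
    rw [nonempty_compl]
    rintro rfl
    exact NormedSpace.unbounded_univ ℝ Plane (hb.subset hUΩ)
  have hf0 : ∀ x ∉ U, f x = 0 := fun x hx => by
    simp only [hf, Metric.infDist_zero_of_mem (show x ∈ Uᶜ from hx)]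
    norm_num
  have hpos : ∀ x ∈ U, 0 < f x := fun x hx =>
    hf ▸ lt_min one_pos ((hUo.isClosed_compl.notMem_iff_infDist_pos hUne).1 (by simpa using hx))
  obtain ⟨ψ, hψ, -⟩ := hlip.representsH10 hΩ hb fun x hx => hf0 x fun h => hx (hUΩ h)
  obtain ⟨x₀, hx₀⟩ := hne
  refine ⟨fun _ => 0, 0, 1, fun _ => 1, fun _ => c, ψ, ?_, fun _ => ?_,
    fun x hx => ?_, ?_, ?_, ?_⟩
  · exact LipschitzWith.const 0
  · have hsub : U ⊆ {x | x ∈ U ∧ ω x = c} := fun x hx => ⟨hx, hconst x hx⟩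
    exact ⟨x₀, interior_maximal hsub hUo hx₀⟩
  · refine ⟨fun _ => 0, fun _ => ?_, by simp⟩
    simp [filledStep, hc x hx]
  · filter_upwards [hψ] with x hx
    refine ⟨fun hxU => ⟨fun _ => f x, fun _ => ?_, by simp [hx]⟩, fun hxU => by
      rw [hx, hf0 x hxU]⟩
    have h1 : f x ≤ 1 := by simp [hf]
    simp [filledStep, hconst x hxU, (hpos x hxU).le, h1]
  · refine mem_ker_poissonOp hΩ hb hω.continuousOn hw hM hωw' ψ
      (LipschitzWith.const (0 : ℝ)) ?_
    filter_upwards [hψ] with x hx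
    rw [hx, gradient_fun_const]
    by_cases hxU : x ∈ U
    · have : w =ᶠ[𝓝 x] fun _ => c := by
        filter_upwards [hUo.mem_nhds hxU] with z hz
        rw [← hωw' z (hUΩ hz), hconst z hz]
      rw [this.gradient_eq, gradient_fun_const, smul_zero]
    · rw [hf0 x hxU, zero_smul]
  · exact H10.ne_zero_of_fn_ae_eq hΩ hlip.continuous hψ (hUΩ hx₀) (hpos x₀ hx₀).ne'

/-- On a region bounded by the level `c` on which `ω` is not constant, `(ω - c) 1_U` is a
kernel element. -/
lemma exists_ker_of_ne_const {Ω : Set Plane} (hΩ : IsOpen Ω)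
    (hb : Bornology.IsBounded Ω) {ω : Plane → ℝ} {K : ℝ≥0} (hω : LipschitzOnWith K ω (closure Ω))
    {U : Set Plane} (hUo : IsOpen U) (hUΩ : U ⊆ Ω) {c : ℝ} (hc : ∀ x ∈ frontier U, ω x = c)
    {x₀ : Plane} (hx₀ : x₀ ∈ U) (hx₀c : ω x₀ ≠ c) :
    ∃ (gL : ℝ → ℝ) (L : ℝ≥0) (ν : ℕ) (α h : Fin ν → ℝ) (ψ : H10 Ω),
        LipschitzWith L gL ∧
        (∀ l, IsPlateauHeight U ω (h l)) ∧
        (∀ x ∈ frontier U, 0 ∈ filledFun gL α h (ω x)) ∧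
        (∀ᵐ x ∂(volume.restrict Ω),
          (x ∈ U → ψ.fn x ∈ filledFun gL α h (ω x)) ∧ (x ∉ U → ψ.fn x = 0)) ∧
        ψ ∈ (poissonOp Ω hb ω hω.continuousOn).ker ∧ ψ ≠ 0 := by
  obtain ⟨w, M, hw, hM, hωw⟩ := exists_bounded_lipschitz_extension hb hω
  have hωw' : ∀ x ∈ Ω, ω x = w x := fun x hx => hωw x (subset_closure hx)
  have hfr : ∀ x ∈ frontier U, w x = c := fun x hx => by
    rw [← hωw x (closure_mono hUΩ (frontier_subset_closure hx)), hc x hx]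
  obtain ⟨f, hf⟩ : ∃ f : Plane → ℝ, f = U.indicator fun x => w x - c := ⟨_, rfl⟩
  have hlip : LipschitzWith K f := hf ▸
    lipschitzWith_indicator_of_frontier (f := fun x => w x - c)
      (by simpa using hw.sub (LipschitzWith.const c)) fun x hx => by simp [hfr x hx]
  have hfU : ∀ x ∈ U, f x = w x - c := fun x hx => by rw [hf, indicator_of_mem hx]
  have hf0 : ∀ x ∉ U, f x = 0 := fun x hx => by rw [hf, indicator_of_notMem hx]
  obtain ⟨ψ, hψ, -⟩ := hlip.representsH10 hΩ hb fun x hx => hf0 x fun h => hx (hUΩ h)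
  refine ⟨fun ξ => ξ - c, 1, 0, Fin.elim0, Fin.elim0, ψ, ?_, fun l => l.elim0,
    fun x hx => ?_, ?_, ?_, H10.ne_zero_of_fn_ae_eq hΩ hlip.continuous hψ (hUΩ hx₀) ?_⟩
  · simpa using LipschitzWith.id.sub (LipschitzWith.const c)
  · exact ⟨Fin.elim0, fun l => l.elim0, by simp [hc x hx]⟩
  · filter_upwards [hψ, ae_restrict_mem hΩ.measurableSet] with x hx hxΩ
    refine ⟨fun hxU => ⟨Fin.elim0, fun l => l.elim0, ?_⟩, fun hxU => by rw [hx, hf0 x hxU]⟩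
    rw [hx, hfU x hxU, hωw' x hxΩ]
    simp
  · -- `ψ ∇ω = ψ ∇ψ` is the gradient of `ψ² / 2`
    obtain ⟨N, hN⟩ : ∃ N : ℝ≥0, ∀ x, |f x| ≤ N := by
      refine ⟨M + ‖c‖₊, fun x => ?_⟩
      by_cases hxU : x ∈ U
      · rw [hfU x hxU]
        exact (norm_sub_le (w x) c).trans (add_le_add_left (hM x) ‖c‖)
      · rw [hf0 x hxU, abs_zero]
        exact NNReal.coe_nonneg _
    obtain ⟨H, L, hH, hHf⟩ := hlip.exists_gradient_eq_smul_gradient hN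
    refine mem_ker_poissonOp hΩ hb hω.continuousOn hw hM hωw' ψ hH ?_
    filter_upwards [hψ, ae_restrict_of_ae hHf] with x hx hHx
    rw [hx, hHx]
    by_cases hxU : x ∈ U
    · have : f =ᶠ[𝓝 x] fun z => w z - c := by
        filter_upwards [hUo.mem_nhds hxU] with z hz
        exact hfU z hz
      rw [this.gradient_eq, gradient, gradient, fderiv_sub_const]
    · rw [hf0 x hxU, zero_smul, zero_smul]
  · rw [hfU x₀ hx₀, ← hωw' x₀ (hUΩ hx₀)]
    exact sub_ne_zero.2 hx₀c

lemma exists_ker_of_boundedByLevelSet {Ω : Set Plane} (hΩ : IsOpen Ω)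
    (hb : Bornology.IsBounded Ω) {ω : Plane → ℝ} {K : ℝ≥0} (hω : LipschitzOnWith K ω (closure Ω))
    {U : Set Plane} (hU : BoundedByLevelSet Ω ω U) (hne : U.Nonempty) :
    ∃ (gL : ℝ → ℝ) (L : ℝ≥0) (ν : ℕ) (α h : Fin ν → ℝ) (ψ : H10 Ω),
        LipschitzWith L gL ∧
        (∀ l, IsPlateauHeight U ω (h l)) ∧
        (∀ x ∈ frontier U, 0 ∈ filledFun gL α h (ω x)) ∧
        (∀ᵐ x ∂(volume.restrict Ω),
          (x ∈ U → ψ.fn x ∈ filledFun gL α h (ω x)) ∧ (x ∉ U → ψ.fn x = 0)) ∧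
        ψ ∈ (poissonOp Ω hb ω hω.continuousOn).ker ∧ ψ ≠ 0 := by
  obtain ⟨hUo, hUΩ, c, hc⟩ := hU
  by_cases hconst : ∀ x ∈ U, ω x = c
  · exact exists_ker_of_eq_const hΩ hb hω hUo hUΩ hc hne hconst
  · push Not at hconst
    obtain ⟨x₀, hx₀, hx₀c⟩ := hconst
    exact exists_ker_of_ne_const hΩ hb hω hUo hUΩ hc hx₀ hx₀c

/-! ### Existence of `g(ω)` when the plateaus fill the gaps -/

/-- If the plateaus fill the gaps at the jumps, a selection of `g(ω)` is Lipschitz, and on the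
boundary it can be made to vanish. -/
lemma exists_H10_mem_filledFun {Ω : Set Plane} (hΩ : IsOpen Ω) (hb : Bornology.IsBounded Ω)
    {ω : Plane → ℝ} {K : ℝ≥0} (hω : LipschitzOnWith K ω (closure Ω)) {gL : ℝ → ℝ} {L : ℝ≥0}
    {ν : ℕ} {α h : Fin ν → ℝ} (hgL : LipschitzWith L gL)
    (h0 : ∀ x ∈ frontier Ω, 0 ∈ filledFun gL α h (ω x))
    (hgap : ∀ l, Disjoint (closure {x | x ∈ Ω ∧ ω x < h l}) (closure {x | x ∈ Ω ∧ h l < ω x}))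
    (hfr : ∀ x ∈ frontier Ω, filledFun gL α h (ω x) = {0} ∨ ∀ᶠ y in 𝓝[Ω] x, ω y = ω x) :
    ∃ ψ : H10 Ω, ∀ᵐ x ∂(volume.restrict Ω), ψ.fn x ∈ filledFun gL α h (ω x) := by
  obtain ⟨w, M, hw, hM, hωw⟩ := exists_bounded_lipschitz_extension hb hω
  have hfrc : frontier Ω ⊆ closure Ω := frontier_subset_closure
  -- a selection `y c` of the step values giving `0 ∈ g(c)`, depending on the height `c` only
  have hsel : ∀ c, ∃ y : Fin ν → ℝ, 0 ∈ filledFun gL α h c →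
      (∀ l, y l ∈ filledStep (c - h l)) ∧ 0 = gL c + ∑ l, α l * y l := by
    intro c
    by_cases hc : 0 ∈ filledFun gL α h c
    · obtain ⟨y, hy⟩ := hc
      exact ⟨y, fun _ => hy⟩
    · exact ⟨0, fun h => absurd h hc⟩
  choose y hy using hsel
  -- the step functions `η l`, with the selected value near the part of `∂Ω` at height `h l`
  have hη : ∀ l, ∃ (η : Plane → ℝ) (C : ℝ≥0), LipschitzWith C η ∧
      (∀ x ∈ closure Ω, η x ∈ filledStep (w x - h l)) ∧
      ∀ x ∈ frontier Ω, w x = h l → filledFun gL α h (h l) ≠ {0} → η x = y (h l) l := by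
    intro l
    set A := closure {x | x ∈ Ω ∧ ω x < h l}
    set B := closure {x | x ∈ Ω ∧ h l < ω x}
    set D := {x | x ∈ frontier Ω ∧ w x = h l ∧ filledFun gL α h (h l) ≠ {0}} with hD
    have hBc : IsCompact B := hb.isCompact_closure.of_isClosed_subset isClosed_closure
      (closure_mono fun x hx => hx.1)
    have hDc : IsCompact D := by
      refine hb.isCompact_closure.of_isClosed_subset ?_ fun x hx => hfrc hx.1
      exact isClosed_frontier.inter
        ((isClosed_eq hw.continuous continuous_const).inter isClosed_const)
    have hconst : ∀ x ∈ D, ∀ᶠ z in 𝓝[Ω] x, ω z = h l := by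
      rintro x ⟨hx, hxl, hne⟩
      rw [← hωw x (hfrc hx)] at hxl
      have := (hfr x hx).resolve_left (by rwa [hxl])
      rwa [hxl] at this
    have hdisj : ∀ {P : Plane → Prop}, (∀ z, P z → ω z ≠ h l) →
        Disjoint (closure {x | x ∈ Ω ∧ P x}) D := by
      intro P hP
      refine disjoint_left.2 fun x hx hxD => ?_
      have h1 := eventually_nhdsWithin_iff.1 (hconst x hxD)
      obtain ⟨z, hz, hzΩ, hzP⟩ := mem_closure_iff_nhds.1 hx _ h1
      exact hP z hzP (hz hzΩ)
    obtain ⟨t, ht, hty⟩ : ∃ t ∈ Icc (0 : ℝ) 1, ∀ x ∈ D, t = y (h l) l := by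
      rcases D.eq_empty_or_nonempty with hDe | ⟨x, hx, hxl, -⟩
      · exact ⟨0, by simp, by simp [hDe]⟩
      · have h1 := h0 x hx
        rw [hωw x (hfrc hx), hxl] at h1
        exact ⟨_, ((hy _ h1).1 l).2.1 (sub_self _), fun _ _ => rfl⟩
    obtain ⟨η, C, hC, hA0, hB1, hDt, hI⟩ := exists_lipschitz_three_values (A := A) isClosed_closure
      hBc hDc (hgap l) (hdisj fun z hz => hz.ne) (hdisj fun z hz => hz.ne') ht
    refine ⟨η, C, hC, fun x hx => ⟨fun hlt => ?_, fun _ => hI x, fun hgt => ?_⟩,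
      fun x hx hxl hne => ?_⟩
    · refine hA0 x (mem_closure_iff_nhds.2 fun V hV => ?_)
      have hV' : V ∩ {z | w z < h l} ∈ 𝓝 x :=
        inter_mem hV (hw.continuous.continuousAt.eventually_lt_const (by linarith))
      obtain ⟨z, ⟨hzV, hz⟩, hzΩ⟩ := mem_closure_iff_nhds.1 hx _ hV'
      exact ⟨z, hzV, hzΩ, by rw [hωw z (subset_closure hzΩ)]; exact hz⟩
    · refine hB1 x (mem_closure_iff_nhds.2 fun V hV => ?_)
      have hV' : V ∩ {z | h l < w z} ∈ 𝓝 x :=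
        inter_mem hV (hw.continuous.continuousAt.eventually_const_lt (by linarith))
      obtain ⟨z, ⟨hzV, hz⟩, hzΩ⟩ := mem_closure_iff_nhds.1 hx _ hV'
      exact ⟨z, hzV, hzΩ, by rw [hωw z (subset_closure hzΩ)]; exact hz⟩
    · have hxD : x ∈ D := ⟨hx, hxl, hne⟩
      rw [hDt x hxD, hty x hxD]
  choose η C hC hηs hηD using hη
  obtain ⟨C', hC'⟩ := exists_lipschitzWith_sum Finset.univ
    (f := fun (l : Fin ν) x => α l * η l x) fun l => ⟨_, (lipschitzWith_smul (α l)).comp (hC l)⟩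
  have hlip := (hgL.comp hw).add hC'
  set F : Plane → ℝ := fun x => (gL ∘ w) x + ∑ l, α l * η l x with hF
  have hmem : ∀ x ∈ closure Ω, F x ∈ filledFun gL α h (ω x) := fun x hx =>
    ⟨fun l => η l x, fun l => by rw [hωw x hx]; exact hηs l x hx, by simp [hF, hωw x hx]⟩
  have hF0 : ∀ x ∈ frontier Ω, F x = 0 := by
    intro x hx
    by_cases hg : filledFun gL α h (ω x) = {0}
    · have := hmem x (hfrc hx)
      rwa [hg] at this
    · have hx0 := hy _ (h0 x hx)
      rw [hωw x (hfrc hx)] at hx0 hg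
      have he : ∀ l, η l x = y (w x) l := by
        intro l
        have h1 := hηs l x (hfrc hx)
        have h2 := hx0.1 l
        rcases lt_trichotomy (w x - h l) 0 with hlt | heq | hgt
        · rw [h1.1 hlt, h2.1 hlt]
        · have hxl : w x = h l := sub_eq_zero.1 heq
          rw [hηD l x hx hxl (hxl ▸ hg), hxl]
        · rw [h1.2.2 hgt, h2.2.2 hgt]
      simp only [hF, he, Function.comp_apply]
      exact hx0.2.symm
  obtain ⟨ψ, hψ, -⟩ := (lipschitzWith_indicator_of_frontier hlip hF0).representsH10 hΩ hb
    fun x hx => indicator_of_notMem hx _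
  refine ⟨ψ, ?_⟩
  filter_upwards [hψ, ae_restrict_mem hΩ.measurableSet] with x hx hxΩ
  rw [hx, indicator_of_mem hxΩ]
  exact hmem x (subset_closure hxΩ)

/-! ### The kernel of the weak Poisson operator -/

theorem theorem1
    (Ω : Set Plane) (hΩ : IsOpen Ω) (hb : Bornology.IsBounded Ω)
    (ω : Plane → ℝ) (K : ℝ≥0) (hω : LipschitzOnWith K ω (closure Ω))
    (hne : (innerRegion Ω ω).Nonempty) :
    -- the kernel contains nontrivial elements
    (∃ ψ : H10 Ω, ψ ∈ (poissonOp Ω hb ω hω.continuousOn).ker ∧ ψ ≠ 0) ∧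
    -- every region bounded by a level set carries a nontrivial kernel element of the form `g(ω)`
    (∀ U : Set Plane, BoundedByLevelSet Ω ω U → U.Nonempty →
      ∃ (gL : ℝ → ℝ) (L : ℝ≥0) (ν : ℕ) (α h : Fin ν → ℝ) (ψ : H10 Ω),
        LipschitzWith L gL ∧
        (∀ l, IsPlateauHeight U ω (h l)) ∧
        (∀ x ∈ frontier U, 0 ∈ filledFun gL α h (ω x)) ∧
        (∀ᵐ x ∂(volume.restrict Ω),
          (x ∈ U → ψ.fn x ∈ filledFun gL α h (ω x)) ∧ (x ∉ U → ψ.fn x = 0)) ∧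
        ψ ∈ (poissonOp Ω hb ω hω.continuousOn).ker ∧ ψ ≠ 0) ∧
    -- for every `g` as in the theorem ...
    (∀ (gL : ℝ → ℝ) (L : ℝ≥0) (ν : ℕ) (α h : Fin ν → ℝ),
      LipschitzWith L gL →
      (∀ l, IsPlateauHeight Ω ω (h l)) →
      (∀ x ∈ frontier Ω, 0 ∈ filledFun gL α h (ω x)) →
      -- ... every `ψ = g(ω)` in the domain `H¹₀` is a kernel element,
      (∀ ψ : H10 Ω, (∀ᵐ x ∂(volume.restrict Ω), ψ.fn x ∈ filledFun gL α h (ω x)) →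
        ψ ∈ (poissonOp Ω hb ω hω.continuousOn).ker) ∧
      -- ... and there is one as soon as the plateaus fill the gaps at the jumps
      ((∀ l, Disjoint (closure {x | x ∈ Ω ∧ ω x < h l}) (closure {x | x ∈ Ω ∧ h l < ω x})) →
        (∀ x ∈ frontier Ω, filledFun gL α h (ω x) = {0} ∨ ∀ᶠ y in 𝓝[Ω] x, ω y = ω x) →
        ∃ ψ : H10 Ω, ψ ∈ (poissonOp Ω hb ω hω.continuousOn).ker ∧
          ∀ᵐ x ∂(volume.restrict Ω), ψ.fn x ∈ filledFun gL α h (ω x))) := by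
  have ha := fun U (hU : BoundedByLevelSet Ω ω U) (hUne : U.Nonempty) =>
    exists_ker_of_boundedByLevelSet hΩ hb hω hU hUne
  refine ⟨?_, ha, fun gL L ν α h hgL _ h0 => ⟨fun ψ hψ =>
    mem_ker_of_ae_mem_filledFun hΩ hb hω hgL hψ, fun hgap hfr => ?_⟩⟩
  · obtain ⟨x, U, hU, hx⟩ := hne
    obtain ⟨_, _, _, _, _, ψ, _, _, _, _, hker, hψ⟩ := ha U hU ⟨x, hx⟩
    exact ⟨ψ, hker, hψ⟩
  · obtain ⟨ψ, hψ⟩ := exists_H10_mem_filledFun hΩ hb hω hgL h0 hgap hfr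
    exact ⟨ψ, mem_ker_of_ae_mem_filledFun hΩ hb hω hgL hψ, hψ⟩
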